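/- All vector spaces are over $\mathbb C$. A local Lie algebra is a direct sum $\Gamma=\Gamma_{-1}\oplus\Gamma_0\oplus\Gamma_1$ of finite-dimensional spaces with bilinear anticommutative brackets $\Gamma_i\times\Gamma_j\to\Gamma_{i+j}$ for $|i+j|\le 1$, satisfying $[x,[y,z]]=[[x,y],z]+[y,[x,z]]$ whenever the three terms are defined. Let $\mathfrak g_{max}(\Gamma)$ be the maximal graded Lie algebra with local part $\Gamma$, that is, the Lie algebra generated by the vector space $\Gamma$ subject to the brackets defined in $\Gamma$, with its natural $\mathbb Z$-grading, and let $\mathfrak g_{min}(\Gamma)=\bigoplus_{i\in\mathbb Z}(\mathfrak g_{min}(\Gamma))_i$ be its quotient by the largest graded ideal that meets $\Gamma$ trivially. For every integer $n\ge 2$, the element $[Y_1,[Y_2,[\dots,[Y_{n-1},[X_1,[\dots,[X_{n-1},X_n]\dots]$ of the free Lie algebra on $Y_1,\dots,Y_{n-1},X_1,\dots,X_n$ can be written as a linear combination of Lie monomials each of which makes sense in every local Lie algebra for $Y_i\in\Gamma_{-1}$, $X_j\in\Gamma_1$ (giving $Y_i$ degree $-1$ and $X_j$ degree $1$, every bracket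 in the monomial is between monomials whose degrees have a sum in $\{-1,0,1\}$). For each $n\ge 2$ let $\mathcal P_n(Y_1,\dots,Y_{n-1},X_1,\dots,X_n)$ be any such expression. Then for every local Lie algebra $\Gamma$: 1) For every $n\ge 2$, the following are equivalent: (a) $(\mathfrak g_{min}(\Gamma))_i=\{0\}$ for all $i\ge n$; (b) $\mathcal P_n(Y_1,\dots,Y_{n-1},X_1,\dots,X_n)=0$ in $\Gamma$ for all $X_i\in\Gamma_1$ and all $Y_j\in\Gamma_{-1}$. 2) For every $n\ge 2$, the following are equivalent: (a) $(\mathfrak g_{min}(\Gamma))_i=\{0\}$ for all $i\le -n$; (b) $\mathcal P_n(X_1,\dots,X_{n-1},Y_1,\dots,Y_n)=0$ in $\Gamma$ for all $X_i\in\Gamma_1$ and all $Y_j\in\Gamma_{-1}$. 3) $\dim\mathfrak g_{min}(\Gamma)<+\infty$ if and only if there exist integers $m,n\ge 2$ such that $\mathcal P_m(Y_1,\dots,Y_{m-1},X_1,\dots,X_m)=0$ and $\mathcal P_n(X_1,\dots,X_{n-1},Y_1,\dots,Y_n)=0$ in $\Gamma$ for all $X_i\in\Gamma_1$ and all $Y_j\in\Gamma_{-1}$.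 -/

import Mathlib

noncomputable section

/-- A local Lie algebra over `ℂ`: a direct sum `Γ = Γ₋₁ ⊕ Γ₀ ⊕ Γ₁` of finite dimensional subspaces
with bilinear anticommutative brackets `Γᵢ × Γⱼ → Γᵢ₊ⱼ` for `|i + j| ≤ 1`, such that the Jacobi
identity holds whenever its three terms are defined.

The subspaces are indexed by `ℤ` with `Γᵢ = 0` for `|i| > 1`. The partially defined bracket is
stored as a bilinear map on `Γ`, extended by zero: `bracket_mem` forces the value
`0` on `Γᵢ × Γⱼ` when `|i + j| > 1`. -/
structure LocalLieAlgebra (Γ : Type*) [AddCommGroup Γ] [Module ℂ Γ] where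
  /-- the homogeneous subspaces -/
  piece : ℤ → Submodule ℂ Γ
  isInternal : DirectSum.IsInternal piece
  piece_eq_bot : ∀ i : ℤ, 1 < |i| → piece i = ⊥
  finiteDimensional : ∀ i : ℤ, FiniteDimensional ℂ (piece i)
  /-- the partial bracket, extended by zero -/
  bracket : Γ →ₗ[ℂ] Γ →ₗ[ℂ] Γ
  bracket_mem : ∀ (i j : ℤ) (x y : Γ), x ∈ piece i → y ∈ piece j → bracket x y ∈ piece (i + j)
  anticomm : ∀ (i j : ℤ) (x y : Γ), x ∈ piece i → y ∈ piece j → |i + j| ≤ 1 →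
    bracket x y = -bracket y x
  jacobi : ∀ (i j k : ℤ) (x y z : Γ), x ∈ piece i → y ∈ piece j → z ∈ piece k →
    |i + j| ≤ 1 → |j + k| ≤ 1 → |i + k| ≤ 1 → |i + j + k| ≤ 1 →
    bracket x (bracket y z) = bracket (bracket x y) z + bracket y (bracket x z)

namespace LocalLieAlgebra

variable {Γ : Type*} [AddCommGroup Γ] [Module ℂ Γ] (G : LocalLieAlgebra Γ)

/-- The defining relators of the maximal graded Lie algebra, in the free Lie algebra on the set `Γ`:
the generators depend linearly on the element of `Γ`, and all brackets that are defined in `Γ`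
agree with those of `Γ`. -/
inductive MaxRelator : FreeLieAlgebra ℂ Γ → Prop
  | add (x y : Γ) : MaxRelator
      (FreeLieAlgebra.of ℂ (x + y) - FreeLieAlgebra.of ℂ x - FreeLieAlgebra.of ℂ y)
  | smul (c : ℂ) (x : Γ) : MaxRelator (FreeLieAlgebra.of ℂ (c • x) - c • FreeLieAlgebra.of ℂ x)
  | bracket (i j : ℤ) (x y : Γ) (hx : x ∈ G.piece i) (hy : y ∈ G.piece j) (hij : |i + j| ≤ 1) :
      MaxRelator (⁅FreeLieAlgebra.of ℂ x, FreeLieAlgebra.of ℂ y⁆ -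
        FreeLieAlgebra.of ℂ (G.bracket x y))

/-- The maximal graded Lie algebra with local part `Γ`: the universal Lie algebra receiving a linear
map from `Γ` which respects all brackets that are defined in `Γ`. -/
abbrev GMax : Type _ :=
  FreeLieAlgebra ℂ Γ ⧸ LieSubmodule.lieSpan ℂ (FreeLieAlgebra ℂ Γ) {r | G.MaxRelator r}

/-- The canonical map from `Γ` to the maximal graded Lie algebra. -/
def toGMax (x : Γ) : G.GMax := LieSubmodule.Quotient.mk (FreeLieAlgebra.of ℂ x)

/-- Lie monomials of degree `i` in homogeneous elements of `Γ`. -/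
inductive IsMonomial : ℤ → G.GMax → Prop
  | of (i : ℤ) (x : Γ) (hx : x ∈ G.piece i) : IsMonomial i (G.toGMax x)
  | lie (i j : ℤ) (a b : G.GMax) (ha : IsMonomial i a) (hb : IsMonomial j b) :
      IsMonomial (i + j) ⁅a, b⁆

/-- The homogeneous subspace of degree `i` of the maximal graded Lie algebra. -/
def gMaxPiece (i : ℤ) : Submodule ℂ G.GMax := Submodule.span ℂ {a | G.IsMonomial i a}

/-- Graded ideals of the maximal graded Lie algebra: those spanned by their homogeneous elements. -/
def IsGradedIdeal (I : LieIdeal ℂ G.GMax) : Prop :=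
  I.toSubmodule = ⨆ i : ℤ, I.toSubmodule ⊓ G.gMaxPiece i

/-- The largest graded ideal of the maximal graded Lie algebra which intersects (the image of) `Γ`
trivially, as the sum of all such ideals. -/
def jMax : LieIdeal ℂ G.GMax :=
  sSup {I | G.IsGradedIdeal I ∧ ∀ x : Γ, G.toGMax x ∈ I → G.toGMax x = 0}

/-- The minimal graded Lie algebra with local part `Γ`. -/
abbrev GMin : Type _ := G.GMax ⧸ G.jMax

/-- The homogeneous subspace of degree `i` of the minimal graded Lie algebra. -/
def gMinPiece (i : ℤ) : Submodule ℂ G.GMin :=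
  (G.gMaxPiece i).map (LieSubmodule.Quotient.mk' G.jMax : G.GMax →ₗ[ℂ] G.GMin)

end LocalLieAlgebra

/-- Evaluation of a nonassociative monomial for a given binary operation. -/
def evalMonomial {α M : Type*} (op : M → M → M) (f : α → M) : FreeMagma α → M
  | .of a => f a
  | .mul u v => op (evalMonomial op f u) (evalMonomial op f v)

/-- Formal linear combinations of nonassociative monomials, i.e. Lie polynomials written out as
explicit linear combinations of bracketings of the variables. -/
abbrev LiePolyExpr (α : Type*) := FreeMagma α →₀ ℂ

/-- Evaluation of a formal linear combination of bracketings, for a given binary operation. -/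
def LiePolyExpr.eval {α M : Type*} [AddCommGroup M] [Module ℂ M] (op : M → M → M) (f : α → M)
    (P : LiePolyExpr α) : M :=
  P.sum fun u c => c • evalMonomial op f u

/-- The `2n - 1` variables `Y₁, …, Yₙ₋₁` (left summand) and `X₁, …, Xₙ` (right summand). -/
abbrev LieVar (n : ℕ) := Fin (n - 1) ⊕ Fin n

/-- The degree of a monomial when each `Yᵢ` has degree `-1` and each `Xⱼ` has degree `1`. -/
def monomialDegree {n : ℕ} : FreeMagma (LieVar n) → ℤ
  | .of (.inl _) => -1
  | .of (.inr _) => 1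
  | .mul u v => monomialDegree u + monomialDegree v

/-- The monomial makes sense in every local Lie algebra when `Yᵢ ∈ Γ₋₁` and `Xⱼ ∈ Γ₁`:
each bracket occurring in it is one of the brackets `Γᵢ × Γⱼ → Γᵢ₊ⱼ` with `|i + j| ≤ 1`. -/
def MakesSenseLocally {n : ℕ} : FreeMagma (LieVar n) → Prop
  | .of _ => True
  | .mul u v => MakesSenseLocally u ∧ MakesSenseLocally v ∧
      |monomialDegree u + monomialDegree v| ≤ 1

/-- The right-nested bracket `[a₁, [a₂, […, [aₖ₋₁, aₖ]…]]]`. -/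
def nestedLie {L : Type*} [LieRing L] : List L → L
  | [] => 0
  | [a] => a
  | a :: b :: l => ⁅a, nestedLie (b :: l)⁆

/-- `P` is an expression of `[Y₁, [Y₂, […, [Yₙ₋₁, [X₁, […, [Xₙ₋₁, Xₙ]…]` in the free Lie algebra
on the variables `Y₁, …, Yₙ₋₁, X₁, …, Xₙ` as a linear combination of monomials
each of which makes sense in local Lie algebras. -/
def IsLocalExpression (n : ℕ) (P : LiePolyExpr (LieVar n)) : Prop :=
  (∀ u ∈ P.support, MakesSenseLocally u) ∧
  P.eval (fun a b => ⁅a, b⁆) (FreeLieAlgebra.of ℂ) =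
    nestedLie (List.ofFn (fun i : Fin (n - 1) => FreeLieAlgebra.of ℂ (Sum.inl i : LieVar n)) ++
      List.ofFn (fun j : Fin n => FreeLieAlgebra.of ℂ (Sum.inr j : LieVar n)))

/-- The identity `P(A₁, …, Aₙ₋₁, B₁, …, Bₙ) = 0` holds in the local Lie algebra for all `Aᵢ ∈ Γ_d`
and all `Bⱼ ∈ Γ₋d` (used for `d = -1` and `d = 1`). -/
def LocalLieAlgebra.IdentityHolds {Γ : Type*} [AddCommGroup Γ] [Module ℂ Γ] (G : LocalLieAlgebra Γ)
    (d : ℤ) {n : ℕ} (P : LiePolyExpr (LieVar n)) : Prop :=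
  ∀ (A : Fin (n - 1) → Γ) (B : Fin n → Γ), (∀ i, A i ∈ G.piece d) → (∀ j, B j ∈ G.piece (-d)) →
    P.eval (fun a b => G.bracket a b) (Sum.elim A B) = 0

end

/-! Let e be 1 or -1; both signs are treated at once. Using the Jacobi identity, any monomial of
degree ek in `GMax` is rewritten as a combination of right-nested brackets of k elements of the
image of Γ_e (`gMaxPiece_mul`). Every local expression, read in `GMax`, is therefore the nested
bracket of A's acting on a nested bracket of B's (`toGMax_eval`), and the B-brackets span degree en.

If the identity holds, degree en consists of elements killed by all (n-1)-fold brackets with Γ_{-e}.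
Elements killed in this sense, over all degrees, are stable under Γ_e, Γ_0 and Γ_{-e}. They thus
form a graded ideal living in degrees of absolute value at least 2, which lies in `jMax`
(`annihilated_le_jMax`). Bracketing with Γ_e carries the property from degree en to all further
degrees, so the minimal algebra vanishes there. Conversely, if degree en lies in `jMax`, so do the
brackets of the A's with the B's; these come from Γ, and `jMax` meets the image of Γ trivially
(`jMax_le_far`), so the expression is zero in `GMax`.

It remains to return from `GMax` to Γ. In degrees ±1 the map is injective, because the local
brackets are realised by operators on a tensor algebra: left multiplications, derivations and
lowering operators (`lie_tensorRep`). In degree 0 another argument is used. An expression need not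
be homogeneous: it may contain degree-0 monomials, whose sum vanishes in the free Lie algebra. These
have even length, so each of their length components vanishes there separately. Scaling all letters
by 1 + ε over the dual numbers turns a monomial z of length k into z + kεz, and a module in which x
+ εy sends a fixed vector to y detects kz (`eval_eq_zero_of_length_eq`).

Finite dimensionality follows because the graded pieces are finite-dimensional, independent and
span. -/

noncomputable section

open TensorAlgebra

attribute [local instance 100] LieRing.ofAssociativeRing

/-! ### Operators on a tensor algebra prescribed by their commutators with vectors -/

namespace TensorAlgebra

variable {A B V : Type*} [AddCommGroup A] [Module ℂ A] [AddCommGroup B] [Module ℂ B]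
  [AddCommGroup V] [Module ℂ V]

/-- Left multiplication by a vector, as an operator on the tensor algebra. -/
def mulLeftι : V →ₗ[ℂ] Module.End ℂ (TensorAlgebra ℂ V) :=
  LinearMap.mul ℂ (TensorAlgebra ℂ V) ∘ₗ ι ℂ

@[simp] theorem mulLeftι_apply (v : V) (t : TensorAlgebra ℂ V) : mulLeftι v t = ι ℂ v * t := rfl

/-- Auxiliary operators on pairs, whose products applied to `(1, 0)` give `(t, E t)`, where
`E` is the operator with `E 1 = 0` and `E (v t) = g v t + v (E t)`. -/
def twistAux (g : V →ₗ[ℂ] Module.End ℂ (TensorAlgebra ℂ V)) :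
    V →ₗ[ℂ] Module.End ℂ (TensorAlgebra ℂ V × TensorAlgebra ℂ V) where
  toFun v := ((mulLeftι v).comp (LinearMap.fst ℂ _ _)).prod
    ((g v).comp (LinearMap.fst ℂ _ _) + (mulLeftι v).comp (LinearMap.snd ℂ _ _))
  map_add' v w := by
    ext <;> simp
  map_smul' c v := by
    ext <;> simp

/-- The operator `E` with `E 1 = 0` and `[E, v] = g v` for all vectors `v`. -/
def twistFun (g : V →ₗ[ℂ] Module.End ℂ (TensorAlgebra ℂ V)) :
    Module.End ℂ (TensorAlgebra ℂ V) where
  toFun t := (lift ℂ (twistAux g) t (1, 0)).2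
  map_add' s t := by simp
  map_smul' c t := by simp

theorem twistFun_one (g : V →ₗ[ℂ] Module.End ℂ (TensorAlgebra ℂ V)) : twistFun g 1 = 0 := by
  simp [twistFun]

theorem lift_twistAux_fst (g : V →ₗ[ℂ] Module.End ℂ (TensorAlgebra ℂ V)) (t : TensorAlgebra ℂ V) :
    ∀ s, (lift ℂ (twistAux g) t s).1 = t * s.1 := by
  induction t using TensorAlgebra.induction with
  | algebraMap r => intro s; simp [Algebra.algebraMap_eq_smul_one]
  | ι v => intro s; simp [twistAux]
  | mul a b ha hb => intro s; simp [ha, hb, mul_assoc]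
  | add a b ha hb => intro s; simp [ha, hb, add_mul]

theorem twistFun_ι_mul (g : V →ₗ[ℂ] Module.End ℂ (TensorAlgebra ℂ V)) (v : V)
    (t : TensorAlgebra ℂ V) : twistFun g (ι ℂ v * t) = g v t + ι ℂ v * twistFun g t := by
  have h : (lift ℂ (twistAux g) t (1, 0)).1 = t := by simp [lift_twistAux_fst]
  change (lift ℂ (twistAux g) (ι ℂ v * t) (1, 0)).2 = _
  rw [map_mul, lift_ι_apply, Module.End.mul_apply]
  change g v (lift ℂ (twistAux g) t (1, 0)).1 + _ = _
  rw [h]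
  rfl

theorem lie_twistFun_mulLeftι (g : V →ₗ[ℂ] Module.End ℂ (TensorAlgebra ℂ V)) (v : V) :
    ⁅twistFun g, mulLeftι v⁆ = g v := by
  ext t
  simp [Ring.lie_def, twistFun_ι_mul]

/-- An operator on the tensor algebra is determined by its value at `1` and its commutators with
the left multiplications by vectors. -/
theorem end_ext {S T : Module.End ℂ (TensorAlgebra ℂ V)} (h1 : S 1 = T 1)
    (h : ∀ v : V, ⁅S, mulLeftι v⁆ = ⁅T, mulLeftι v⁆) : S = T := by
  have key : ∀ t s : TensorAlgebra ℂ V, S s = T s → S (t * s) = T (t * s) := by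
    intro t
    induction t using TensorAlgebra.induction with
    | algebraMap r => intro s hs; simp [Algebra.algebraMap_eq_smul_one, hs]
    | ι v =>
      intro s hs
      have := LinearMap.congr_fun (h v) s
      simpa [Ring.lie_def, hs] using this
    | mul a b ha hb => intro s hs; rw [mul_assoc]; exact ha _ (hb _ hs)
    | add a b ha hb => intro s hs; rw [add_mul, map_add, map_add, ha _ hs, hb _ hs]
  apply LinearMap.ext
  intro t
  simpa using key t 1 h1

/-- `twistFun` as a linear map. -/
def twist : (V →ₗ[ℂ] Module.End ℂ (TensorAlgebra ℂ V)) →ₗ[ℂ] Module.End ℂ (TensorAlgebra ℂ V) where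
  toFun := twistFun
  map_add' g g' := end_ext (by simp [twistFun_one])
    fun v => by simp [add_lie, lie_twistFun_mulLeftι]
  map_smul' c g := end_ext (by simp [twistFun_one])
    fun v => by simp [lie_twistFun_mulLeftι]

@[simp] theorem twist_one (g : V →ₗ[ℂ] Module.End ℂ (TensorAlgebra ℂ V)) : twist g 1 = 0 :=
  twistFun_one g

theorem lie_twist_mulLeftι (g : V →ₗ[ℂ] Module.End ℂ (TensorAlgebra ℂ V)) (v : V) :
    ⁅twist g, mulLeftι v⁆ = g v := lie_twistFun_mulLeftι g v

/-- The derivation of the tensor algebra which extends `act b : V → V`. -/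
def derivOp (act : B →ₗ[ℂ] V →ₗ[ℂ] V) : B →ₗ[ℂ] Module.End ℂ (TensorAlgebra ℂ V) :=
  twist ∘ₗ LinearMap.llcomp ℂ V V (Module.End ℂ (TensorAlgebra ℂ V)) mulLeftι ∘ₗ act

/-- The lowering operators on the tensor algebra, with `[E y, v] = D (pair y v)`. -/
def lowerOp (act : B →ₗ[ℂ] V →ₗ[ℂ] V) (pair : A →ₗ[ℂ] V →ₗ[ℂ] B) :
    A →ₗ[ℂ] Module.End ℂ (TensorAlgebra ℂ V) :=
  twist ∘ₗ LinearMap.llcomp ℂ V B (Module.End ℂ (TensorAlgebra ℂ V)) (derivOp act) ∘ₗ pair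

variable (act : B →ₗ[ℂ] V →ₗ[ℂ] V) (pair : A →ₗ[ℂ] V →ₗ[ℂ] B)

@[simp] theorem derivOp_one (b : B) : derivOp act b 1 = 0 := twist_one _

@[simp] theorem lowerOp_one (a : A) : lowerOp act pair a 1 = 0 := twist_one _

theorem lie_derivOp_mulLeftι (b : B) (v : V) :
    ⁅derivOp act b, mulLeftι v⁆ = mulLeftι (act b v) := lie_twist_mulLeftι _ v

theorem lie_lowerOp_mulLeftι (a : A) (v : V) :
    ⁅lowerOp act pair a, mulLeftι v⁆ = derivOp act (pair a v) := lie_twist_mulLeftι _ v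

theorem derivOp_ι (b : B) (v : V) : derivOp act b (ι ℂ v) = ι ℂ (act b v) := by
  have := LinearMap.congr_fun (lie_derivOp_mulLeftι act b v) 1
  simpa [Ring.lie_def] using this

/-- Both sides kill 1, so by `end_ext` it suffices to compare commutators with vectors, where the
claim is the relation `h` on `V`. -/
theorem lie_derivOp_derivOp {b c d : B}
    (h : ∀ v, act d v = act b (act c v) - act c (act b v)) :
    ⁅derivOp act b, derivOp act c⁆ = derivOp act d := by
  refine end_ext (by simp [Ring.lie_def]) fun v => ?_
  rw [lie_lie, lie_derivOp_mulLeftι, lie_derivOp_mulLeftι, lie_derivOp_mulLeftι,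
    lie_derivOp_mulLeftι, lie_derivOp_mulLeftι, h, map_sub]

/-- Commuting both sides with a vector reduces the claim to `h`, an operator form of the Jacobi
identity in degrees 0, -e, e. -/
theorem lie_derivOp_lowerOp {b : B} {a a' : A}
    (h : ∀ v, ⁅derivOp act b, derivOp act (pair a v)⁆ =
      derivOp act (pair a' v) + derivOp act (pair a (act b v))) :
    ⁅derivOp act b, lowerOp act pair a⁆ = lowerOp act pair a' := by
  refine end_ext (by simp [Ring.lie_def]) fun v => ?_
  rw [lie_lie, lie_derivOp_mulLeftι, lie_lowerOp_mulLeftι, lie_lowerOp_mulLeftι,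
    lie_lowerOp_mulLeftι, h, add_sub_cancel_right]

end TensorAlgebra

/-! ### Homogeneous projections of a local Lie algebra -/

namespace LocalLieAlgebra

variable {Γ : Type*} [AddCommGroup Γ] [Module ℂ Γ] (G : LocalLieAlgebra Γ)

/-- The projection of a local Lie algebra onto its homogeneous subspace of degree `i`. -/
def proj (i : ℤ) : Γ →ₗ[ℂ] Γ :=
  (G.piece i).subtype ∘ₗ DirectSum.component ℂ ℤ (fun i => G.piece i) i ∘ₗ
    (LinearEquiv.ofBijective (DirectSum.coeLinearMap G.piece) G.isInternal).symm.toLinearMap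

theorem proj_mem (i : ℤ) (x : Γ) : G.proj i x ∈ G.piece i := Submodule.coe_mem _

theorem proj_of_mem {i : ℤ} {x : Γ} (hx : x ∈ G.piece i) : G.proj i x = x :=
  congrArg Subtype.val (G.isInternal.ofBijective_coeLinearMap_of_mem hx)

theorem proj_of_mem_ne {i j : ℤ} {x : Γ} (hx : x ∈ G.piece i) (hij : i ≠ j) : G.proj j x = 0 :=
  congrArg Subtype.val (G.isInternal.ofBijective_coeLinearMap_of_mem_ne hij hx)

theorem eq_zero_of_mem {i : ℤ} {x : Γ} (hi : 1 < |i|) (hx : x ∈ G.piece i) : x = 0 := by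
  rw [G.piece_eq_bot i hi] at hx
  exact (Submodule.mem_bot ℂ).1 hx

theorem proj_add_proj_add_proj (x : Γ) : G.proj 1 x + G.proj 0 x + G.proj (-1) x = x := by
  have hx : x ∈ iSup G.piece := by
    rw [G.isInternal.submodule_iSup_eq_top]; trivial
  induction hx using Submodule.iSup_induction' with
  | mem i x hx =>
    by_cases hi : 1 < |i|
    · rw [G.eq_zero_of_mem hi hx]; simp
    · have : i = 1 ∨ i = 0 ∨ i = -1 := by rw [lt_abs] at hi; omega
      rcases this with rfl | rfl | rfl
      · rw [G.proj_of_mem hx, G.proj_of_mem_ne hx (by decide), G.proj_of_mem_ne hx (by decide)]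
        simp
      · rw [G.proj_of_mem hx, G.proj_of_mem_ne hx (by decide), G.proj_of_mem_ne hx (by decide)]
        simp
      · rw [G.proj_of_mem hx, G.proj_of_mem_ne hx (by decide), G.proj_of_mem_ne hx (by decide)]
        simp
  | zero => simp
  | add x y _ _ hx hy =>
    -- The fourth occurrence is the one on the right-hand side.
    nth_rewrite 4 [← hx]
    nth_rewrite 4 [← hy]
    simp only [map_add]
    abel

/-! ### Dual numbers over a local Lie algebra -/

/-- The bracket of `Γ ⊗ ℂ[ε]`, where `(x, x')` stands for `x + ε x'`. -/
def dualBracket : Γ × Γ →ₗ[ℂ] Γ × Γ →ₗ[ℂ] Γ × Γ :=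
  LinearMap.mk₂ ℂ (fun a b => (G.bracket a.1 b.1, G.bracket a.1 b.2 + G.bracket a.2 b.1))
    (fun a a' b => by ext <;> simp; abel) (fun c a b => by ext <;> simp)
    (fun a b b' => by ext <;> simp; abel) (fun c a b => by ext <;> simp)

@[simp] theorem dualBracket_apply (a b : Γ × Γ) : G.dualBracket a b =
    (G.bracket a.1 b.1, G.bracket a.1 b.2 + G.bracket a.2 b.1) := rfl

/-- The homogeneous subspaces of `Γ ⊗ ℂ[ε]`. -/
def dualPiece (i : ℤ) : Submodule ℂ (Γ × Γ) := (G.piece i).prod (G.piece i)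

theorem dualBracket_mem {i j : ℤ} {a b : Γ × Γ} (ha : a ∈ G.dualPiece i) (hb : b ∈ G.dualPiece j) :
    G.dualBracket a b ∈ G.dualPiece (i + j) :=
  ⟨G.bracket_mem i j _ _ ha.1 hb.1,
    add_mem (G.bracket_mem i j _ _ ha.1 hb.2) (G.bracket_mem i j _ _ ha.2 hb.1)⟩

theorem dualBracket_anticomm {i j : ℤ} {a b : Γ × Γ} (ha : a ∈ G.dualPiece i)
    (hb : b ∈ G.dualPiece j) (hij : |i + j| ≤ 1) : G.dualBracket a b = -G.dualBracket b a := by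
  ext
  · exact G.anticomm i j _ _ ha.1 hb.1 hij
  · simp only [dualBracket_apply, Prod.snd_neg]
    rw [G.anticomm i j _ _ ha.1 hb.2 hij, G.anticomm i j _ _ ha.2 hb.1 hij]
    abel

theorem dualBracket_jacobi {i j k : ℤ} {a b c : Γ × Γ} (ha : a ∈ G.dualPiece i)
    (hb : b ∈ G.dualPiece j) (hc : c ∈ G.dualPiece k) (hij : |i + j| ≤ 1) (hjk : |j + k| ≤ 1)
    (hik : |i + k| ≤ 1) (hijk : |i + j + k| ≤ 1) :
    G.dualBracket a (G.dualBracket b c) =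
      G.dualBracket (G.dualBracket a b) c + G.dualBracket b (G.dualBracket a c) := by
  have J := fun x y z hx hy hz => G.jacobi i j k x y z hx hy hz hij hjk hik hijk
  ext
  · exact J _ _ _ ha.1 hb.1 hc.1
  · simp only [dualBracket_apply, Prod.snd_add, map_add, LinearMap.add_apply]
    rw [J _ _ _ ha.1 hb.1 hc.2, J _ _ _ ha.1 hb.2 hc.1, J _ _ _ ha.2 hb.1 hc.1]
    abel

/-- The projections of `Γ ⊗ ℂ[ε]` onto its homogeneous subspaces. -/
def dualProj (i : ℤ) : Γ × Γ →ₗ[ℂ] Γ × Γ := (G.proj i).prodMap (G.proj i)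

theorem dualProj_mem (i : ℤ) (a : Γ × Γ) : G.dualProj i a ∈ G.dualPiece i :=
  ⟨G.proj_mem i _, G.proj_mem i _⟩

theorem dualProj_of_mem {i : ℤ} {a : Γ × Γ} (ha : a ∈ G.dualPiece i) : G.dualProj i a = a :=
  Prod.ext (G.proj_of_mem ha.1) (G.proj_of_mem ha.2)

theorem dualProj_of_mem_ne {i j : ℤ} {a : Γ × Γ} (ha : a ∈ G.dualPiece i) (hij : i ≠ j) :
    G.dualProj j a = 0 :=
  Prod.ext (G.proj_of_mem_ne ha.1 hij) (G.proj_of_mem_ne ha.2 hij)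

/-! ### The representation on a tensor algebra -/

/-- The action of the degree zero part of `Γ ⊗ ℂ[ε]` on the direct sum of the part of degree `e` of
`Γ ⊗ ℂ[ε]` with the module `Γ₀ ⊕ ℂ v`, on which `x + ε y` maps `v` to `y`. -/
def dualAct (e : ℤ) : Γ × Γ →ₗ[ℂ] (Γ × Γ) × (Γ × ℂ) →ₗ[ℂ] (Γ × Γ) × (Γ × ℂ) :=
  LinearMap.mk₂ ℂ (fun a v => (G.dualBracket (G.dualProj 0 a) (G.dualProj e v.1),
      (G.bracket (G.proj 0 a.1) (G.proj 0 v.2.1) + v.2.2 • G.proj 0 a.2, 0)))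
    (fun a a' b => by ext <;> simp; abel)
    (fun c a b => by ext <;> simp [smul_comm c])
    (fun a b b' => by ext <;> simp [add_smul] <;> abel)
    (fun c a b => by ext <;> simp [mul_smul])

/-- The bracket of the part of degree `-e` with the part of degree `e`. -/
def dualPair (e : ℤ) : Γ × Γ →ₗ[ℂ] (Γ × Γ) × (Γ × ℂ) →ₗ[ℂ] Γ × Γ :=
  (G.dualBracket.compl₁₂ (G.dualProj (-e)) (G.dualProj e)).compl₂ (LinearMap.fst ℂ _ _)

theorem dualAct_apply {e : ℤ} {a : Γ × Γ} (ha : a ∈ G.dualPiece 0) (v : (Γ × Γ) × (Γ × ℂ)) :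
    G.dualAct e a v = (G.dualBracket a (G.dualProj e v.1),
      (G.bracket a.1 (G.proj 0 v.2.1) + v.2.2 • a.2, 0)) := by
  change (G.dualBracket (G.dualProj 0 a) (G.dualProj e v.1),
    (G.bracket (G.dualProj 0 a).1 (G.proj 0 v.2.1) + v.2.2 • (G.dualProj 0 a).2, (0 : ℂ))) = _
  rw [G.dualProj_of_mem ha]

theorem dualPair_apply {e : ℤ} {a : Γ × Γ} (ha : a ∈ G.dualPiece (-e)) (v : (Γ × Γ) × (Γ × ℂ)) :
    G.dualPair e a v = G.dualBracket a (G.dualProj e v.1) := by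
  change G.dualBracket (G.dualProj (-e) a) (G.dualProj e v.1) = _
  rw [G.dualProj_of_mem ha]

/-- The representation of `Γ ⊗ ℂ[ε]` on a tensor algebra, on which the part of degree `e` acts by
left multiplications. -/
def tensorRep (e : ℤ) : Γ × Γ →ₗ[ℂ] Module.End ℂ (TensorAlgebra ℂ ((Γ × Γ) × (Γ × ℂ))) :=
  mulLeftι ∘ₗ LinearMap.inl ℂ _ _ ∘ₗ G.dualProj e + derivOp (G.dualAct e) ∘ₗ G.dualProj 0 +
    lowerOp (G.dualAct e) (G.dualPair e) ∘ₗ G.dualProj (-e)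

theorem tensorRep_of_mem {e : ℤ} (he : e = 1 ∨ e = -1) {a : Γ × Γ} (ha : a ∈ G.dualPiece e) :
    G.tensorRep e a = mulLeftι (a, 0) := by
  simp [tensorRep, G.dualProj_of_mem ha, G.dualProj_of_mem_ne ha (show e ≠ 0 by omega),
    G.dualProj_of_mem_ne ha (show e ≠ -e by omega)]

theorem tensorRep_of_mem_zero {e : ℤ} (he : e = 1 ∨ e = -1) {a : Γ × Γ} (ha : a ∈ G.dualPiece 0) :
    G.tensorRep e a = derivOp (G.dualAct e) a := by
  simp [tensorRep, G.dualProj_of_mem ha, G.dualProj_of_mem_ne ha (show 0 ≠ e by omega),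
    G.dualProj_of_mem_ne ha (show 0 ≠ -e by omega)]
  exact map_zero mulLeftι

theorem tensorRep_of_mem_neg {e : ℤ} (he : e = 1 ∨ e = -1) {a : Γ × Γ} (ha : a ∈ G.dualPiece (-e)) :
    G.tensorRep e a = lowerOp (G.dualAct e) (G.dualPair e) a := by
  simp [tensorRep, G.dualProj_of_mem ha, G.dualProj_of_mem_ne ha (show -e ≠ 0 by omega),
    G.dualProj_of_mem_ne ha (show -e ≠ e by omega)]
  exact map_zero mulLeftι

/-- On the degree-e summand this is the Jacobi identity over the dual numbers. On Γ₀ ⊕ ℂv it holds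
because the ε-part of [x + εy, x' + εy'] is [x, y'] - [x', y], which is what the commutator of the
two actions does to v. -/
theorem lie_derivOp_dualAct {e : ℤ} (he : e = 1 ∨ e = -1) {a b : Γ × Γ}
    (ha : a ∈ G.dualPiece 0) (hb : b ∈ G.dualPiece 0) :
    ⁅derivOp (G.dualAct e) a, derivOp (G.dualAct e) b⁆ =
      derivOp (G.dualAct e) (G.dualBracket a b) := by
  have h0 : |(0 : ℤ) + 0| ≤ 1 := by simp
  have h1 : |0 + e| ≤ 1 := by rcases he with rfl | rfl <;> simp
  refine lie_derivOp_derivOp _ fun v => ?_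
  have hab := G.dualBracket_mem ha hb
  rw [add_zero] at hab
  have hv := G.dualProj_mem e v.1
  have hm := G.proj_mem 0 v.2.1
  have mem : ∀ {c : Γ × Γ}, c ∈ G.dualPiece 0 →
      G.dualProj e (G.dualBracket c (G.dualProj e v.1)) = G.dualBracket c (G.dualProj e v.1) :=
    fun hc => G.dualProj_of_mem (by simpa using G.dualBracket_mem hc hv)
  have mem0 : ∀ {c : Γ × Γ}, c ∈ G.dualPiece 0 →
      G.proj 0 (G.bracket c.1 (G.proj 0 v.2.1) + v.2.2 • c.2) =
        G.bracket c.1 (G.proj 0 v.2.1) + v.2.2 • c.2 :=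
    fun hc => G.proj_of_mem (add_mem (by simpa using G.bracket_mem 0 0 _ _ hc.1 hm)
      (Submodule.smul_mem _ _ hc.2))
  rw [G.dualAct_apply hab, G.dualAct_apply ha (G.dualAct e b v),
    G.dualAct_apply hb (G.dualAct e a v), G.dualAct_apply ha, G.dualAct_apply hb]
  refine Prod.ext ?_ (Prod.ext ?_ ?_)
  · simp only [Prod.fst_sub]
    rw [mem ha, mem hb]
    exact eq_sub_of_add_eq (G.dualBracket_jacobi ha hb hv h0 h1 h1 (by simpa using h1)).symm
  · simp only [Prod.fst_sub, Prod.snd_sub]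
    rw [mem0 ha, mem0 hb]
    simp only [map_add, map_smul, dualBracket_apply, zero_smul, add_zero]
    rw [G.jacobi 0 0 0 _ _ _ ha.1 hb.1 hm (by simp) (by simp) (by simp) (by simp),
      G.anticomm 0 0 _ _ ha.2 hb.1 (by simp), smul_add, smul_neg]
    abel
  · simp

theorem lie_derivOp_lowerOp_dualAct {e : ℤ} (he : e = 1 ∨ e = -1) {a b : Γ × Γ}
    (ha : a ∈ G.dualPiece 0) (hb : b ∈ G.dualPiece (-e)) :
    ⁅derivOp (G.dualAct e) a, lowerOp (G.dualAct e) (G.dualPair e) b⁆ =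
      lowerOp (G.dualAct e) (G.dualPair e) (G.dualBracket a b) := by
  refine lie_derivOp_lowerOp _ _ fun v => ?_
  have hab := G.dualBracket_mem ha hb
  rw [zero_add] at hab
  have hv := G.dualProj_mem e v.1
  have hbv := G.dualBracket_mem hb hv
  rw [neg_add_cancel] at hbv
  have hav : G.dualProj e (G.dualBracket a (G.dualProj e v.1)) =
      G.dualBracket a (G.dualProj e v.1) :=
    G.dualProj_of_mem (by simpa using G.dualBracket_mem ha hv)
  rw [G.dualPair_apply hb, G.dualPair_apply hab, G.dualPair_apply hb, G.dualAct_apply ha]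
  dsimp only
  rw [hav, G.lie_derivOp_dualAct he ha hbv, ← map_add, G.dualBracket_jacobi ha hb hv]
  all_goals rcases he with rfl | rfl <;> simp

theorem lie_lowerOp_mulLeftι_dualPair {e : ℤ} {a b : Γ × Γ} (ha : a ∈ G.dualPiece (-e))
    (hb : b ∈ G.dualPiece e) :
    ⁅lowerOp (G.dualAct e) (G.dualPair e) a, mulLeftι ((b, 0) : (Γ × Γ) × (Γ × ℂ))⁆ =
      derivOp (G.dualAct e) (G.dualBracket a b) := by
  rw [lie_lowerOp_mulLeftι, G.dualPair_apply ha, G.dualProj_of_mem hb]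

theorem lie_derivOp_mulLeftι_dualAct {e : ℤ} {a b : Γ × Γ} (ha : a ∈ G.dualPiece 0)
    (hb : b ∈ G.dualPiece e) :
    ⁅derivOp (G.dualAct e) a, mulLeftι ((b, 0) : (Γ × Γ) × (Γ × ℂ))⁆ =
      mulLeftι ((G.dualBracket a b, 0) : (Γ × Γ) × (Γ × ℂ)) := by
  rw [lie_derivOp_mulLeftι, G.dualAct_apply ha, G.dualProj_of_mem hb]
  simp only [Prod.fst_zero, Prod.snd_zero, map_zero, zero_smul, add_zero]
  rfl

/-- `tensorRep` respects the brackets which are defined in the local Lie algebra. -/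
theorem lie_tensorRep {e : ℤ} (he : e = 1 ∨ e = -1) {i j : ℤ} {a b : Γ × Γ}
    (ha : a ∈ G.dualPiece i) (hb : b ∈ G.dualPiece j) (hij : |i + j| ≤ 1) :
    ⁅G.tensorRep e a, G.tensorRep e b⁆ = G.tensorRep e (G.dualBracket a b) := by
  have vanish : ∀ {k : ℤ} {c : Γ × Γ}, 1 < |k| → c ∈ G.dualPiece k → c = 0 := fun hk hc =>
    Prod.ext (G.eq_zero_of_mem hk hc.1) (G.eq_zero_of_mem hk hc.2)
  by_cases hi : 1 < |i|
  · rw [vanish hi ha]; simp only [map_zero, LinearMap.zero_apply, zero_lie]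
  by_cases hj : 1 < |j|
  · rw [vanish hj hb]; simp only [map_zero, lie_zero]
  have hab := G.dualBracket_mem ha hb
  have anti := G.dualBracket_anticomm ha hb hij
  have hba := G.dualBracket_mem hb ha
  have hi' : i = e ∨ i = 0 ∨ i = -e := by rw [lt_abs] at hi; omega
  have hj' : j = e ∨ j = 0 ∨ j = -e := by rw [lt_abs] at hj; omega
  rw [abs_le] at hij
  -- Of the nine cases, (e, e) and (-e, -e) are excluded by `hij`; (e, 0), (e, -e) and (-e, 0) are
  -- reduced to their transposes by anticommutativity.
  rcases hi' with rfl | rfl | rfl <;> rcases hj' with rfl | rfl | rfl <;>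
    try simp only [zero_add, add_zero, neg_add_cancel, add_neg_cancel] at hab hba
  · omega
  · rw [anti, map_neg, G.tensorRep_of_mem he ha, G.tensorRep_of_mem_zero he hb,
      G.tensorRep_of_mem he hba, ← G.lie_derivOp_mulLeftι_dualAct hb ha, lie_skew]
  · rw [anti, map_neg, G.tensorRep_of_mem he ha, G.tensorRep_of_mem_neg he hb,
      G.tensorRep_of_mem_zero he hba, ← G.lie_lowerOp_mulLeftι_dualPair hb ha, lie_skew]
  · rw [G.tensorRep_of_mem_zero he ha, G.tensorRep_of_mem he hb, G.tensorRep_of_mem he hab,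
      G.lie_derivOp_mulLeftι_dualAct ha hb]
  · rw [G.tensorRep_of_mem_zero he ha, G.tensorRep_of_mem_zero he hb,
      G.tensorRep_of_mem_zero he hab, G.lie_derivOp_dualAct he ha hb]
  · rw [G.tensorRep_of_mem_zero he ha, G.tensorRep_of_mem_neg he hb,
      G.tensorRep_of_mem_neg he hab, G.lie_derivOp_lowerOp_dualAct he ha hb]
  · rw [G.tensorRep_of_mem_neg he ha, G.tensorRep_of_mem he hb, G.tensorRep_of_mem_zero he hab,
      G.lie_lowerOp_mulLeftι_dualPair ha hb]
  · rw [anti, map_neg, G.tensorRep_of_mem_neg he ha, G.tensorRep_of_mem_zero he hb,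
      G.tensorRep_of_mem_neg he hba, ← G.lie_derivOp_lowerOp_dualAct he hb ha, lie_skew]
  · omega

theorem tensorRep_one (e : ℤ) (a : Γ × Γ) :
    G.tensorRep e a 1 = ι ℂ ((G.dualProj e a, 0) : (Γ × Γ) × (Γ × ℂ)) := by
  simp [tensorRep]

/-- The canonical map to the maximal graded Lie algebra is injective in degrees `1` and `-1`. -/
theorem proj_eq_zero_of_toGMax_eq_zero {e : ℤ} (he : e = 1 ∨ e = -1) {x : Γ}
    (hx : G.toGMax x = 0) : G.proj e x = 0 := by
  set φ := FreeLieAlgebra.lift ℂ (fun y : Γ => G.tensorRep e (y, 0)) with hφ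
  have hrel : LieSubmodule.lieSpan ℂ (FreeLieAlgebra ℂ Γ) {r | G.MaxRelator r} ≤ φ.ker := by
    rw [LieSubmodule.lieSpan_le]
    rintro r (⟨x, y⟩ | ⟨c, x⟩ | ⟨i, j, x, y, hx, hy, hij⟩)
    · rw [SetLike.mem_coe, LieHom.mem_ker]
      rw [map_sub, map_sub]
      simp only [hφ, FreeLieAlgebra.lift_of_apply]
      rw [← map_sub, ← map_sub, show ((x + y, 0) - (x, 0) - (y, 0) : Γ × Γ) = 0 by ext <;> simp,
        map_zero]
    · rw [SetLike.mem_coe, LieHom.mem_ker]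
      rw [map_sub, map_smul]
      simp only [hφ, FreeLieAlgebra.lift_of_apply]
      rw [← map_smul, ← map_sub, show ((c • x, 0) - c • (x, 0) : Γ × Γ) = 0 by ext <;> simp,
        map_zero]
    · rw [SetLike.mem_coe, LieHom.mem_ker]
      simp only [hφ, map_sub, LieHom.map_lie, FreeLieAlgebra.lift_of_apply]
      rw [G.lie_tensorRep he (i := i) (j := j) ⟨hx, zero_mem _⟩ ⟨hy, zero_mem _⟩ hij]
      simp
  have h0 : φ (FreeLieAlgebra.of ℂ x) = 0 :=
    hrel (LieSubmodule.Quotient.mk_eq_zero'.1 hx)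
  -- Derivations and lowering operators kill 1, so applying the operator to 1 recovers the degree-e
  -- component as a vector.
  have h1 := LinearMap.congr_fun h0 1
  rw [hφ, FreeLieAlgebra.lift_of_apply, G.tensorRep_one, LinearMap.zero_apply,
    ι_eq_zero_iff] at h1
  exact congrArg (fun v => v.1.1) h1

/-- If `(x, y)` has degree zero and acts trivially, then `y = 0`. -/
theorem eq_zero_of_tensorRep_eq_zero {e : ℤ} (he : e = 1 ∨ e = -1) {a : Γ × Γ}
    (ha : a ∈ G.dualPiece 0) (h : G.tensorRep e a = 0) : a.2 = 0 := by
  -- The test vector is the generator v of Γ₀ ⊕ ℂv, which a sends to its ε-part.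
  have h1 := LinearMap.congr_fun h (ι ℂ ((0, (0, 1)) : (Γ × Γ) × (Γ × ℂ)))
  rw [G.tensorRep_of_mem_zero he ha, derivOp_ι, LinearMap.zero_apply, ι_eq_zero_iff,
    G.dualAct_apply ha] at h1
  simpa using congrArg (fun v => v.2.1) h1

end LocalLieAlgebra

/-! ### Spans of right-nested brackets over a local triple -/

section NestedBrackets

variable {L : Type*} [LieRing L] [LieAlgebra ℂ L]

/-- Subspaces of degrees `1`, `0` and `-1` of a Lie algebra, which are closed under the brackets
with values in degrees `-1`, `0`, `1`. -/
structure IsLocalTriple (P Z M : Submodule ℂ L) : Prop where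
  zero_zero : ∀ x ∈ Z, ∀ y ∈ Z, ⁅x, y⁆ ∈ Z
  zero_pos : ∀ x ∈ Z, ∀ y ∈ P, ⁅x, y⁆ ∈ P
  zero_neg : ∀ x ∈ Z, ∀ y ∈ M, ⁅x, y⁆ ∈ M
  neg_pos : ∀ x ∈ M, ∀ y ∈ P, ⁅x, y⁆ ∈ Z

theorem lie_mem_of_lie_mem_swap {S : Submodule ℂ L} {x y : L} (h : ⁅y, x⁆ ∈ S) : ⁅x, y⁆ ∈ S := by
  rw [← lie_skew]; exact neg_mem h

theorem IsLocalTriple.symm {P Z M : Submodule ℂ L} (h : IsLocalTriple P Z M) :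
    IsLocalTriple M Z P :=
  ⟨h.zero_zero, h.zero_neg, h.zero_pos,
    fun x hx y hy => lie_mem_of_lie_mem_swap (h.neg_pos y hy x hx)⟩

/-- The span of the right-nested brackets of `k` elements of `P`, and `Z` for `k = 0`. -/
def nestedSpan (P Z : Submodule ℂ L) : ℕ → Submodule ℂ L
  | 0 => Z
  | 1 => P
  | k + 2 => Submodule.map₂ (LieModule.toEnd ℂ L L : L →ₗ[ℂ] L →ₗ[ℂ] L) P (nestedSpan P Z (k + 1))

@[simp] theorem nestedSpan_zero (P Z : Submodule ℂ L) : nestedSpan P Z 0 = Z := rfl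

@[simp] theorem nestedSpan_one (P Z : Submodule ℂ L) : nestedSpan P Z 1 = P := rfl

theorem lie_mem_nestedSpan_add_two {P Z : Submodule ℂ L} {k : ℕ} {x y : L} (hx : x ∈ P)
    (hy : y ∈ nestedSpan P Z (k + 1)) : ⁅x, y⁆ ∈ nestedSpan P Z (k + 2) :=
  Submodule.apply_mem_map₂ _ hx hy

theorem nestedSpan_add_two_induction {P Z : Submodule ℂ L} {k : ℕ} {S : Submodule ℂ L}
    (h : ∀ x ∈ P, ∀ y ∈ nestedSpan P Z (k + 1), ⁅x, y⁆ ∈ S) : nestedSpan P Z (k + 2) ≤ S :=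
  Submodule.map₂_le.2 h

theorem finiteDimensional_nestedSpan {P Z : Submodule ℂ L} [FiniteDimensional ℂ P]
    [FiniteDimensional ℂ Z] : ∀ k, FiniteDimensional ℂ (nestedSpan P Z k)
  | 0 => ‹FiniteDimensional ℂ Z›
  | 1 => ‹FiniteDimensional ℂ P›
  | k + 2 => by
    have := finiteDimensional_nestedSpan (P := P) (Z := Z) (k + 1)
    exact Module.Finite.iff_fg.2 (Submodule.FG.map₂ _ (Module.Finite.iff_fg.1 ‹_›)
      (Module.Finite.iff_fg.1 this))

/-- The preimage of a subspace under a bracket with a fixed element. -/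
abbrev lieComap (x : L) (S : Submodule ℂ L) : Submodule ℂ L :=
  S.comap (LieModule.toEnd ℂ L L x)

theorem lie_mem_of_mem_nestedSpan_add_two {P Z : Submodule ℂ L} {k : ℕ} {S : Submodule ℂ L}
    {x z : L} (hx : x ∈ nestedSpan P Z (k + 2))
    (h : ∀ p ∈ P, ∀ y ∈ nestedSpan P Z (k + 1), ⁅z, ⁅p, y⁆⁆ ∈ S) : ⁅z, x⁆ ∈ S :=
  nestedSpan_add_two_induction (S := lieComap z S) h hx

namespace IsLocalTriple

variable {P Z M : Submodule ℂ L}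

theorem zero_lie_mem (h : IsLocalTriple P Z M) {z : L} (hz : z ∈ Z) :
    ∀ {k : ℕ} {x : L}, x ∈ nestedSpan P Z k →
    ⁅z, x⁆ ∈ nestedSpan P Z k
  | 0, x, hx => h.zero_zero z hz x hx
  | 1, x, hx => h.zero_pos z hz x hx
  | k + 2, x, hx => by
    refine lie_mem_of_mem_nestedSpan_add_two hx fun p hp y hy => ?_
    rw [leibniz_lie]
    exact add_mem (lie_mem_nestedSpan_add_two (h.zero_pos z hz p hp) hy)
      (lie_mem_nestedSpan_add_two hp (h.zero_lie_mem hz hy))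

theorem pos_lie_mem (h : IsLocalTriple P Z M) {p : L} (hp : p ∈ P) :
    ∀ {k : ℕ} {x : L}, x ∈ nestedSpan P Z k →
    ⁅p, x⁆ ∈ nestedSpan P Z (k + 1)
  | 0, x, hx => lie_mem_of_lie_mem_swap (h.zero_pos x hx p hp)
  | _ + 1, _, hx => lie_mem_nestedSpan_add_two hp hx

/-- Expand [m, [p, y]] = [[m, p], y] + [p, [m, y]]: the first term is an action of `Z`, the second
is shorter by induction. -/
theorem neg_lie_mem (h : IsLocalTriple P Z M) {m : L} (hm : m ∈ M) :
    ∀ {k : ℕ} {x : L}, x ∈ nestedSpan P Z (k + 1) →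
    ⁅m, x⁆ ∈ nestedSpan P Z k
  | 0, x, hx => h.neg_pos m hm x hx
  | k + 1, x, hx => by
    refine lie_mem_of_mem_nestedSpan_add_two hx fun p hp y hy => ?_
    rw [leibniz_lie]
    exact add_mem (h.zero_lie_mem (h.neg_pos m hm p hp) hy)
      (h.pos_lie_mem hp (h.neg_lie_mem hm hy))

/-- Peel letters off the left factor by [[p, z], y] = [p, [z, y]] - [z, [p, y]]; this is what makes
right-nested brackets suffice. -/
theorem nestedSpan_lie_mem (h : IsLocalTriple P Z M) :
    ∀ {i j : ℕ} {x y : L}, x ∈ nestedSpan P Z i → y ∈ nestedSpan P Z j →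
    ⁅x, y⁆ ∈ nestedSpan P Z (i + j)
  | 0, j, x, y, hx, hy => by simpa using h.zero_lie_mem hx hy
  | 1, j, x, y, hx, hy => by simpa [add_comm] using h.pos_lie_mem hx hy
  | i + 2, j, x, y, hx, hy => by
    apply lie_mem_of_lie_mem_swap
    refine lie_mem_of_mem_nestedSpan_add_two hx fun p hp z hz => ?_
    apply lie_mem_of_lie_mem_swap
    rw [lie_lie]
    have h1 := h.pos_lie_mem hp (h.nestedSpan_lie_mem hz hy)
    have h2 := h.nestedSpan_lie_mem hz (h.pos_lie_mem hp hy)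
    rw [show i + 1 + j + 1 = i + 2 + j by ring] at h1
    rw [show i + 1 + (j + 1) = i + 2 + j by ring] at h2
    exact sub_mem h1 h2

theorem nestedSpan_lie_neg_mem (h : IsLocalTriple P Z M) :
    ∀ {i j : ℕ} {x y : L}, x ∈ nestedSpan P Z (i + j) →
    y ∈ nestedSpan M Z j → ⁅x, y⁆ ∈ nestedSpan P Z i
  | i, 0, x, y, hx, hy => lie_mem_of_lie_mem_swap (h.zero_lie_mem hy hx)
  | i, 1, x, y, hx, hy => lie_mem_of_lie_mem_swap (h.neg_lie_mem hy hx)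
  | i, j + 2, x, y, hx, hy => by
    refine lie_mem_of_mem_nestedSpan_add_two hy fun m hm z hz => ?_
    rw [leibniz_lie]
    have h1 : ⁅x, m⁆ ∈ nestedSpan P Z (i + (j + 1)) :=
      lie_mem_of_lie_mem_swap (h.neg_lie_mem hm hx)
    have h2 : ⁅x, z⁆ ∈ nestedSpan P Z (i + 1) :=
      h.nestedSpan_lie_neg_mem (by rwa [show i + 1 + (j + 1) = i + (j + 2) by ring]) hz
    exact add_mem (h.nestedSpan_lie_neg_mem h1 hz) (h.neg_lie_mem hm h2)

/-- Brackets of elements of `M` with a nested bracket of elements of `P`. -/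
theorem foldr_mem_nestedSpan (h : IsLocalTriple P Z M) {k : ℕ} {l : List L}
    (hl : ∀ y ∈ l, y ∈ M) {x : L}
    (hx : x ∈ nestedSpan P Z (l.length + k)) :
    l.foldr (fun a b => ⁅a, b⁆) x ∈ nestedSpan P Z k := by
  induction l generalizing k with
  | nil => simpa using hx
  | cons a l ih =>
    rw [List.forall_mem_cons] at hl
    refine h.neg_lie_mem hl.1 (ih hl.2 ?_)
    rwa [List.length_cons, show l.length + 1 + k = l.length + (k + 1) by ring] at hx

end IsLocalTriple

/-! ### The ideal of annihilated elements -/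

/-- The elements of `nestedSpan P Z k` which are annihilated by all `k - 1`-fold brackets with
elements of `M`. -/
def annihilated (P Z M : Submodule ℂ L) : ℕ → Submodule ℂ L
  | 0 => ⊥
  | 1 => ⊥
  | k + 2 => nestedSpan P Z (k + 2) ⊓ ⨅ y ∈ M, lieComap y (annihilated P Z M (k + 1))

theorem mem_annihilated_add_two {P Z M : Submodule ℂ L} {k : ℕ} {x : L} :
    x ∈ annihilated P Z M (k + 2) ↔
      x ∈ nestedSpan P Z (k + 2) ∧ ∀ y ∈ M, ⁅y, x⁆ ∈ annihilated P Z M (k + 1) := by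
  simp [annihilated]

theorem annihilated_le_nestedSpan (P Z M : Submodule ℂ L) (k : ℕ) :
    annihilated P Z M k ≤ nestedSpan P Z k := by
  match k with
  | 0 => exact bot_le
  | 1 => exact bot_le
  | k + 2 => exact inf_le_left

theorem neg_lie_mem_annihilated {P Z M : Submodule ℂ L} {m : L} (hm : m ∈ M) :
    ∀ {k : ℕ} {x : L}, x ∈ annihilated P Z M (k + 1) → ⁅m, x⁆ ∈ annihilated P Z M k
  | 0, x, hx => by
    rw [(Submodule.mem_bot ℂ).1 hx, lie_zero]; exact zero_mem _
  | k + 1, x, hx => (mem_annihilated_add_two.1 hx).2 m hm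

theorem IsLocalTriple.zero_lie_mem_annihilated {P Z M : Submodule ℂ L} (h : IsLocalTriple P Z M)
    {z : L} (hz : z ∈ Z) :
    ∀ {k : ℕ} {x : L}, x ∈ annihilated P Z M k → ⁅z, x⁆ ∈ annihilated P Z M k
  | 0, x, hx => by rw [(Submodule.mem_bot ℂ).1 hx, lie_zero]; exact zero_mem _
  | 1, x, hx => by rw [(Submodule.mem_bot ℂ).1 hx, lie_zero]; exact zero_mem _
  | k + 2, x, hx => by
    refine mem_annihilated_add_two.2
      ⟨h.zero_lie_mem hz (annihilated_le_nestedSpan _ _ _ _ hx), fun y hy => ?_⟩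
    rw [leibniz_lie]
    exact add_mem (neg_lie_mem_annihilated (lie_mem_of_lie_mem_swap (h.zero_neg z hz y hy)) hx)
      (h.zero_lie_mem_annihilated hz (neg_lie_mem_annihilated hy hx))

/-- By [y, [p, x]] = [[y, p], x] + [p, [y, x]], with [y, p] in `Z` and [y, x] annihilated one degree
lower. With the stability under `Z` and `M`, this yields the ideal property. -/
theorem IsLocalTriple.pos_lie_mem_annihilated {P Z M : Submodule ℂ L} (h : IsLocalTriple P Z M)
    {p : L} (hp : p ∈ P) :
    ∀ {k : ℕ} {x : L}, x ∈ annihilated P Z M k → ⁅p, x⁆ ∈ annihilated P Z M (k + 1)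
  | 0, x, hx => by rw [(Submodule.mem_bot ℂ).1 hx, lie_zero]; exact zero_mem _
  | 1, x, hx => by rw [(Submodule.mem_bot ℂ).1 hx, lie_zero]; exact zero_mem _
  | k + 2, x, hx => by
    refine mem_annihilated_add_two.2
      ⟨h.pos_lie_mem hp (annihilated_le_nestedSpan _ _ _ _ hx), fun y hy => ?_⟩
    rw [leibniz_lie]
    exact add_mem (h.zero_lie_mem_annihilated (h.neg_pos y hy p hp) hx)
      (h.pos_lie_mem_annihilated hp (neg_lie_mem_annihilated hy hx))

theorem IsLocalTriple.mem_annihilated_of_foldr {P Z M : Submodule ℂ L} (h : IsLocalTriple P Z M)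
    {k : ℕ} {x : L} (hx : x ∈ nestedSpan P Z (k + 1))
    (hz : ∀ l : List L, l.length = k → (∀ y ∈ l, y ∈ M) → l.foldr (fun a b => ⁅a, b⁆) x = 0) :
    x ∈ annihilated P Z M (k + 1) := by
  induction k generalizing x with
  | zero => exact (Submodule.mem_bot ℂ).2 (hz [] rfl (by simp))
  | succ k ih =>
    refine mem_annihilated_add_two.2 ⟨hx, fun y hy => ih (h.neg_lie_mem hy hx) fun l hl hM => ?_⟩
    -- The last list entry acts first under `foldr`, so y is appended at the end.
    have := hz (l ++ [y]) (by simp [hl]) (by simpa [or_imp, forall_and] using ⟨hM, hy⟩)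
    simpa using this

theorem IsLocalTriple.nestedSpan_le_annihilated {P Z M : Submodule ℂ L} (h : IsLocalTriple P Z M)
    {n : ℕ} (hn : 1 ≤ n) (hle : nestedSpan P Z n ≤ annihilated P Z M n) {k : ℕ} (hk : n ≤ k) :
    nestedSpan P Z k ≤ annihilated P Z M k := by
  induction k, hk using Nat.le_induction with
  | base => exact hle
  | succ k hk ih =>
    obtain ⟨k, rfl⟩ : ∃ j, k = j + 1 := ⟨k - 1, by omega⟩
    exact nestedSpan_add_two_induction fun x hx y hy => h.pos_lie_mem_annihilated hx (ih hy)

/-! ### Nested brackets -/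

theorem nestedLie_cons {L : Type*} [LieRing L] (a : L) {l : List L} (hl : l ≠ []) :
    nestedLie (a :: l) = ⁅a, nestedLie l⁆ := by
  cases l with
  | nil => exact absurd rfl hl
  | cons b l => rfl

theorem nestedLie_append {L : Type*} [LieRing L] (l : List L) {l' : List L} (hl : l' ≠ []) :
    nestedLie (l ++ l') = l.foldr (fun a b => ⁅a, b⁆) (nestedLie l') := by
  induction l with
  | nil => rfl
  | cons a l ih => rw [List.cons_append, nestedLie_cons _ (by simp [hl]), ih, List.foldr_cons]

theorem nestedLie_map {L L' : Type*} [LieRing L] [LieAlgebra ℂ L] [LieRing L'] [LieAlgebra ℂ L']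
    (φ : L →ₗ⁅ℂ⁆ L') (l : List L) : φ (nestedLie l) = nestedLie (l.map φ) := by
  induction l with
  | nil => exact map_zero φ
  | cons a l ih =>
    by_cases hl : l = []
    · subst hl; rfl
    · rw [nestedLie_cons _ hl, List.map_cons, nestedLie_cons _ (by simpa using hl), LieHom.map_lie,
        ih]

theorem nestedLie_mem_nestedSpan (P Z : Submodule ℂ L) : ∀ {k : ℕ} {l : List L},
    l.length = k + 1 → (∀ x ∈ l, x ∈ P) → nestedLie l ∈ nestedSpan P Z (k + 1)
  | 0, [a], _, h => h a (by simp)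
  | k + 1, a :: b :: l, hk, h => by
    rw [List.forall_mem_cons] at h
    exact lie_mem_nestedSpan_add_two h.1
      (nestedLie_mem_nestedSpan P Z (by simpa using hk) h.2)

theorem nestedSpan_le_span (P Z : Submodule ℂ L) : ∀ k : ℕ, nestedSpan P Z (k + 1) ≤
    Submodule.span ℂ (nestedLie '' {l : List L | l.length = k + 1 ∧ ∀ x ∈ l, x ∈ P})
  | 0 => fun x hx => Submodule.subset_span ⟨[x], ⟨rfl, by rintro _ (_ | ⟨_, ⟨⟩⟩); exact hx⟩, rfl⟩
  | k + 1 => by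
    refine nestedSpan_add_two_induction fun x hx y hy => ?_
    have hy' := nestedSpan_le_span P Z k hy
    refine (Submodule.span_le (p := lieComap x (Submodule.span ℂ _))).2 ?_ hy'
    rintro _ ⟨l, ⟨hl, hP⟩, rfl⟩
    refine Submodule.subset_span ⟨x :: l, ⟨by simp [hl], ?_⟩, ?_⟩
    · simpa using ⟨hx, hP⟩
    · exact nestedLie_cons x (by rintro rfl; simp at hl)

end NestedBrackets

/-! ### Evaluation of linear combinations of monomials -/

section Evaluation

variable {α M M' : Type*} [AddCommGroup M] [Module ℂ M] [AddCommGroup M'] [Module ℂ M']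

theorem LiePolyExpr.eval_eq_linearCombination (op : M → M → M) (f : α → M) (P : LiePolyExpr α) :
    P.eval op f = Finsupp.linearCombination ℂ (evalMonomial op f) P :=
  (Finsupp.linearCombination_apply ℂ P).symm

theorem LiePolyExpr.map_eval (op : M → M → M) (f : α → M) (op' : M' → M' → M') (f' : α → M')
    (φ : M →ₗ[ℂ] M') (P : LiePolyExpr α)
    (h : ∀ u ∈ P.support, φ (evalMonomial op f u) = evalMonomial op' f' u) :
    φ (P.eval op f) = P.eval op' f' := by
  simp only [LiePolyExpr.eval, Finsupp.sum, map_sum, map_smul]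
  exact Finset.sum_congr rfl fun u hu => by rw [h u hu]

theorem map_evalMonomial {L L' : Type*} [LieRing L] [LieAlgebra ℂ L] [LieRing L'] [LieAlgebra ℂ L']
    (φ : L →ₗ⁅ℂ⁆ L') (f : α → L) (u : FreeMagma α) :
    φ (evalMonomial (fun a b => ⁅a, b⁆) f u) = evalMonomial (fun a b => ⁅a, b⁆) (φ ∘ f) u := by
  induction u with
  | ih1 a => rfl
  | ih2 u v hu hv => simp only [evalMonomial, LieHom.map_lie, hu, hv]

theorem LiePolyExpr.lieHom_eval {L L' : Type*} [LieRing L] [LieAlgebra ℂ L] [LieRing L']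
    [LieAlgebra ℂ L'] (φ : L →ₗ⁅ℂ⁆ L') (f : α → L) (P : LiePolyExpr α) :
    φ (P.eval (fun a b => ⁅a, b⁆) f) = P.eval (fun a b => ⁅a, b⁆) (φ ∘ f) :=
  P.map_eval _ _ _ _ (φ : L →ₗ[ℂ] L') fun u _ => map_evalMonomial φ f u

/-- The part of a linear combination of monomials which is homogeneous of degree `k` in the number
of letters. -/
def LiePolyExpr.ofLength (P : LiePolyExpr α) (k : ℕ) : LiePolyExpr α :=
  P.filter fun u => u.length = k

theorem LiePolyExpr.sum_ofLength (P : LiePolyExpr α) {s : Finset ℕ}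
    (hs : ∀ u ∈ P.support, u.length ∈ s) : ∑ k ∈ s, P.ofLength k = P := by
  classical
  ext u
  rw [Finsupp.finsetSum_apply]
  by_cases hu : u ∈ P.support
  · simp [LiePolyExpr.ofLength, Finsupp.filter_apply, hs u hu]
  · simp [LiePolyExpr.ofLength, Finsupp.filter_apply, Finsupp.notMem_support_iff.1 hu]

theorem LiePolyExpr.mem_support_ofLength {P : LiePolyExpr α} {k : ℕ} {u : FreeMagma α}
    (hu : u ∈ (P.ofLength k).support) : u ∈ P.support ∧ u.length = k := by
  simpa [LiePolyExpr.ofLength, Finsupp.support_filter] using hu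

/-- The endomorphism of the free Lie algebra which multiplies all generators by `2`. -/
def doubling (α : Type*) : FreeLieAlgebra ℂ α →ₗ⁅ℂ⁆ FreeLieAlgebra ℂ α :=
  FreeLieAlgebra.lift ℂ fun a => (2 : ℂ) • FreeLieAlgebra.of ℂ a

theorem doubling_evalMonomial (u : FreeMagma α) :
    doubling α (evalMonomial (fun a b => ⁅a, b⁆) (FreeLieAlgebra.of ℂ) u) =
      (2 : ℂ) ^ u.length • evalMonomial (fun a b => ⁅a, b⁆) (FreeLieAlgebra.of ℂ) u := by
  induction u with
  | ih1 a => simp [evalMonomial, doubling]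
  | ih2 u v hu hv =>
    change doubling α ⁅_, _⁆ = (2 : ℂ) ^ (u.length + v.length) • ⁅_, _⁆
    rw [LieHom.map_lie]
    rw [hu, hv, smul_lie, lie_smul, smul_smul, pow_add]

theorem doubling_nestedLie {l : List (FreeLieAlgebra ℂ α)}
    (hl : ∀ x ∈ l, doubling α x = (2 : ℂ) • x) :
    doubling α (nestedLie l) = (2 : ℂ) ^ l.length • nestedLie l := by
  induction l with
  | nil => simp [nestedLie]
  | cons a l ih =>
    rw [List.forall_mem_cons] at hl
    by_cases h : l = []
    · subst h; simpa [nestedLie] using hl.1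
    · rw [nestedLie_cons _ h, LieHom.map_lie, hl.1, ih hl.2, smul_lie, lie_smul, smul_smul,
        List.length_cons, pow_succ']

theorem two_pow_injective : Function.Injective fun k : ℕ => (2 : ℂ) ^ k := fun a b h => by
  have h' : ((2 ^ a : ℕ) : ℂ) = ((2 ^ b : ℕ) : ℂ) := by push_cast; exact h
  exact Nat.pow_right_injective le_rfl (Nat.cast_injective h')

/-- If a linear combination of monomials evaluates to a homogeneous element of the free Lie algebra,
then its other homogeneous parts evaluate to zero. -/
theorem LiePolyExpr.eval_ofLength_eq_zero {P : LiePolyExpr α} {q : FreeLieAlgebra ℂ α}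
    (hP : P.eval (fun a b => ⁅a, b⁆) (FreeLieAlgebra.of ℂ) = q) {m : ℕ}
    (hq : doubling α q = (2 : ℂ) ^ m • q) {k : ℕ} (hk : k ≠ m) :
    (P.ofLength k).eval (fun a b => ⁅a, b⁆) (FreeLieAlgebra.of ℂ) = 0 := by
  classical
  let T : Module.End ℂ (FreeLieAlgebra ℂ α) := (doubling α : _ →ₗ[ℂ] _)
  -- Length is read off from eigenvalues: doubling all generators scales length j by 2^j, and these
  -- numbers are distinct.
  have hind := (Module.End.eigenspaces_iSupIndep T).comp two_pow_injective
  rw [iSupIndep_iff_finsetSum_eq_zero_imp_eq_zero] at hind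
  let w : ℕ → FreeLieAlgebra ℂ α := fun j =>
    (P.ofLength j).eval (fun a b => ⁅a, b⁆) (FreeLieAlgebra.of ℂ)
  have hw : ∀ j, w j ∈ T.eigenspace ((2 : ℂ) ^ j) := fun j => by
    refine Submodule.sum_mem _ fun u hu => Submodule.smul_mem _ _ ?_
    rw [Module.End.mem_eigenspace_iff, ← (LiePolyExpr.mem_support_ofLength hu).2]
    exact doubling_evalMonomial u
  have hq' : q ∈ T.eigenspace ((2 : ℂ) ^ m) := Module.End.mem_eigenspace_iff.2 hq
  let s : Finset ℕ := insert m (insert k (P.support.image FreeMagma.length))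
  have hs : ∑ j ∈ s, w j = q := by
    rw [← hP, ← P.sum_ofLength (s := s) (fun u hu => by
      simp only [s, Finset.mem_insert, Finset.mem_image]; exact Or.inr (Or.inr ⟨u, hu, rfl⟩))]
    simp only [w, LiePolyExpr.eval_eq_linearCombination, map_sum]
  -- Subtracting q at index m gives a family with zero sum, one vector in each eigenspace; hence
  -- every member vanishes, in particular `w k`.
  have := hind s (fun j => w j - if j = m then q else 0) (fun j _ => by
    refine sub_mem (hw j) ?_
    split_ifs with h
    · subst h; exact hq'
    · exact zero_mem _) (by
    rw [Finset.sum_sub_distrib, hs]; simp [s]) k (by simp [s])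
  simpa [hk] using this

end Evaluation

/-! ### Local expressions -/

theorem lie_mem_of_mem_span {L : Type*} [LieRing L] [LieAlgebra ℂ L] {S T : Set L}
    {U : Submodule ℂ L} (h : ∀ a ∈ S, ∀ b ∈ T, ⁅a, b⁆ ∈ U) {x y : L}
    (hx : x ∈ Submodule.span ℂ S) (hy : y ∈ Submodule.span ℂ T) : ⁅x, y⁆ ∈ U := by
  have := Submodule.apply_mem_map₂ (LieModule.toEnd ℂ L L : L →ₗ[ℂ] L →ₗ[ℂ] L) hx hy
  rw [Submodule.map₂_span_span] at this
  refine Submodule.span_le.2 ?_ this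
  rintro _ ⟨a, ha, b, hb, rfl⟩
  exact h a ha b hb

/-- The span of the monomials of degree `i` in the free Lie algebra which make sense in local
Lie algebras. -/
def localSpan (n : ℕ) (i : ℤ) : Submodule ℂ (FreeLieAlgebra ℂ (LieVar n)) :=
  Submodule.span ℂ (evalMonomial (fun a b => ⁅a, b⁆) (FreeLieAlgebra.of ℂ) ''
    {u | MakesSenseLocally u ∧ monomialDegree u = i})

theorem lie_mem_localSpan {n : ℕ} {i j : ℤ} (hij : |i + j| ≤ 1)
    {x y : FreeLieAlgebra ℂ (LieVar n)} (hx : x ∈ localSpan n i) (hy : y ∈ localSpan n j) :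
    ⁅x, y⁆ ∈ localSpan n (i + j) := by
  refine lie_mem_of_mem_span ?_ hx hy
  rintro _ ⟨u, ⟨hu, rfl⟩, rfl⟩ _ ⟨v, ⟨hv, rfl⟩, rfl⟩
  exact Submodule.subset_span ⟨u.mul v, ⟨⟨hu, hv, hij⟩, rfl⟩, rfl⟩

theorem isLocalTriple_localSpan (n : ℕ) :
    IsLocalTriple (localSpan n 1) (localSpan n 0) (localSpan n (-1)) where
  zero_zero _ hx _ hy := by
    simpa using lie_mem_localSpan (i := 0) (j := 0) (by decide) hx hy
  zero_pos _ hx _ hy := by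
    simpa using lie_mem_localSpan (i := 0) (j := 1) (by decide) hx hy
  zero_neg _ hx _ hy := by
    simpa using lie_mem_localSpan (i := 0) (j := (-1)) (by decide) hx hy
  neg_pos _ hx _ hy := by
    simpa using lie_mem_localSpan (i := (-1)) (j := 1) (by decide) hx hy

/-- The spans of local monomials form a local triple inside the free Lie algebra. The n-fold bracket
of the X's, lowered by n - 1 of the Y's, therefore ends in the span of local monomials of degree 1.
-/
theorem exists_isLocalExpression {n : ℕ} (hn : 2 ≤ n) : ∃ P, IsLocalExpression n P := by
  obtain ⟨k, rfl⟩ : ∃ k, n = k + 2 := ⟨n - 2, by omega⟩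
  have h1 : nestedLie (List.ofFn fun j : Fin (k + 2) =>
      FreeLieAlgebra.of ℂ (Sum.inr j : LieVar (k + 2))) ∈
      nestedSpan (localSpan (k + 2) 1) (localSpan (k + 2) 0) (k + 2) := by
    refine nestedLie_mem_nestedSpan _ _ (by simp) fun x hx => ?_
    obtain ⟨j, rfl⟩ := List.mem_ofFn.1 hx
    exact Submodule.subset_span ⟨.of (Sum.inr j), ⟨trivial, rfl⟩, rfl⟩
  have h2 := (isLocalTriple_localSpan (k + 2)).foldr_mem_nestedSpan (k := 1)
    (l := List.ofFn fun i : Fin (k + 2 - 1) => FreeLieAlgebra.of ℂ (Sum.inl i : LieVar (k + 2)))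
    (fun x hx => by
      obtain ⟨i, rfl⟩ := List.mem_ofFn.1 hx
      exact Submodule.subset_span ⟨.of (Sum.inl i), ⟨trivial, rfl⟩, rfl⟩)
    (by rw [List.length_ofFn]; exact h1)
  rw [← nestedLie_append _ (by simp)] at h2
  obtain ⟨P, hP, hPe⟩ := (Finsupp.mem_span_image_iff_linearCombination ℂ).1 h2
  refine ⟨P, fun u hu => (hP hu).1, ?_⟩
  rw [LiePolyExpr.eval_eq_linearCombination, hPe]

/-- Each letter contributes ±1. For local monomials, even length thus means degree 0 and odd length
means degree ±1. -/
theorem monomialDegree_emod_two {n : ℕ} (u : FreeMagma (LieVar n)) :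
    (monomialDegree u - u.length) % 2 = 0 := by
  induction u with
  | ih1 a => rcases a with a | a <;> simp [monomialDegree]
  | ih2 u v hu hv =>
    change (monomialDegree u + monomialDegree v - ((u.length + v.length : ℕ) : ℤ)) % 2 = 0
    push_cast
    omega

theorem MakesSenseLocally.abs_monomialDegree_le {n : ℕ} {u : FreeMagma (LieVar n)}
    (hu : MakesSenseLocally u) : |monomialDegree u| ≤ 1 := by
  match u with
  | .of (.inl _) => simp [monomialDegree]
  | .of (.inr _) => simp [monomialDegree]
  | .mul u v => exact hu.2.2

/-! ### Evaluating local expressions in Γ and in the maximal algebra -/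

namespace LocalLieAlgebra

variable {Γ : Type*} [AddCommGroup Γ] [Module ℂ Γ] (G : LocalLieAlgebra Γ)

/-- `toGMax` as a linear map. -/
def toGMaxₗ : Γ →ₗ[ℂ] G.GMax where
  toFun := G.toGMax
  map_add' x y := by
    have h : FreeLieAlgebra.of ℂ (x + y) - FreeLieAlgebra.of ℂ x - FreeLieAlgebra.of ℂ y ∈
      LieSubmodule.lieSpan ℂ (FreeLieAlgebra ℂ Γ) {r | G.MaxRelator r} :=
      LieSubmodule.subset_lieSpan (.add x y)
    rw [sub_sub] at h
    exact (Submodule.Quotient.eq _).2 h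
  map_smul' c x := by
    have h : FreeLieAlgebra.of ℂ (c • x) - c • FreeLieAlgebra.of ℂ x ∈
      LieSubmodule.lieSpan ℂ (FreeLieAlgebra ℂ Γ) {r | G.MaxRelator r} :=
      LieSubmodule.subset_lieSpan (.smul c x)
    exact (Submodule.Quotient.eq _).2 h

@[simp] theorem toGMaxₗ_apply (x : Γ) : G.toGMaxₗ x = G.toGMax x := rfl

theorem lie_toGMax {i j : ℤ} {x y : Γ} (hx : x ∈ G.piece i) (hy : y ∈ G.piece j)
    (hij : |i + j| ≤ 1) : ⁅G.toGMax x, G.toGMax y⁆ = G.toGMax (G.bracket x y) := by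
  have h : ⁅FreeLieAlgebra.of ℂ x, FreeLieAlgebra.of ℂ y⁆ - FreeLieAlgebra.of ℂ (G.bracket x y) ∈
    LieSubmodule.lieSpan ℂ (FreeLieAlgebra ℂ Γ) {r | G.MaxRelator r} :=
    LieSubmodule.subset_lieSpan (.bracket i j x y hx hy hij)
  rw [toGMax, toGMax, toGMax, ← LieSubmodule.Quotient.mk_bracket]
  exact (Submodule.Quotient.eq _).2 h

variable {n : ℕ} {e : ℤ} {A : Fin (n - 1) → Γ} {B : Fin n → Γ}

theorem evalMonomial_mem (hA : ∀ i, A i ∈ G.piece (-e)) (hB : ∀ j, B j ∈ G.piece e)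
    (u : FreeMagma (LieVar n)) :
    evalMonomial (fun a b => G.bracket a b) (Sum.elim A B) u ∈
      G.piece (e * monomialDegree u) := by
  induction u with
  | ih1 a =>
    rcases a with a | a
    · simpa [evalMonomial, monomialDegree] using hA a
    · simpa [evalMonomial, monomialDegree] using hB a
  | ih2 u v hu hv =>
    change G.bracket _ _ ∈ G.piece (e * (monomialDegree u + monomialDegree v))
    rw [mul_add]
    exact G.bracket_mem _ _ _ _ hu hv

theorem abs_mul_add_mul (he : e = 1 ∨ e = -1) (a b : ℤ) : |e * a + e * b| = |a + b| := by
  rw [← mul_add, abs_mul]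
  rcases he with rfl | rfl <;> simp

theorem toGMax_evalMonomial (he : e = 1 ∨ e = -1) (hA : ∀ i, A i ∈ G.piece (-e))
    (hB : ∀ j, B j ∈ G.piece e) {u : FreeMagma (LieVar n)} (hu : MakesSenseLocally u) :
    G.toGMax (evalMonomial (fun a b => G.bracket a b) (Sum.elim A B) u) =
      evalMonomial (fun a b => ⁅a, b⁆) (G.toGMax ∘ Sum.elim A B) u := by
  induction u with
  | ih1 a => rfl
  | ih2 u v ihu ihv =>
    obtain ⟨hu, hv, huv⟩ := hu
    change G.toGMax (G.bracket _ _) = ⁅evalMonomial _ _ u, evalMonomial _ _ v⁆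
    rw [← ihu hu, ← ihv hv, G.lie_toGMax (G.evalMonomial_mem hA hB u) (G.evalMonomial_mem hA hB v)
      (by rwa [abs_mul_add_mul he])]

/-- Local monomials use only brackets defined in Γ, so their evaluation commutes with the map to
`GMax`; there the defining identity of `P` in the free Lie algebra can be applied. -/
theorem toGMax_eval (he : e = 1 ∨ e = -1) (hA : ∀ i, A i ∈ G.piece (-e))
    (hB : ∀ j, B j ∈ G.piece e) (hn : 2 ≤ n) {P : LiePolyExpr (LieVar n)}
    (hP : IsLocalExpression n P) :
    G.toGMax (P.eval (fun a b => G.bracket a b) (Sum.elim A B)) =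
      (List.ofFn fun i => G.toGMax (A i)).foldr (fun a b => ⁅a, b⁆)
        (nestedLie (List.ofFn fun j => G.toGMax (B j))) := by
  have hq := congrArg (FreeLieAlgebra.lift ℂ (G.toGMax ∘ Sum.elim A B)) hP.2
  rw [LiePolyExpr.lieHom_eval, nestedLie_map, FreeLieAlgebra.of_comp_lift] at hq
  rw [← G.toGMaxₗ_apply, P.map_eval _ _ _ _ G.toGMaxₗ fun u hu =>
    G.toGMax_evalMonomial he hA hB (hP.1 u hu), hq, List.map_append, List.map_ofFn, List.map_ofFn,
    nestedLie_append _ (by simp only [ne_eq, List.ofFn_eq_nil_iff]; omega)]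
  simp only [Function.comp_def, FreeLieAlgebra.lift_of_apply, Sum.elim_inl, Sum.elim_inr]

/-- The image of a monomial under `tensorRep`, at the point `(1 + ε) (A, B)`. -/
theorem tensorRep_evalMonomial (he : e = 1 ∨ e = -1) (hA : ∀ i, A i ∈ G.piece (-e))
    (hB : ∀ j, B j ∈ G.piece e) {u : FreeMagma (LieVar n)} (hu : MakesSenseLocally u) :
    G.tensorRep e (evalMonomial (fun a b => G.bracket a b) (Sum.elim A B) u,
        (u.length : ℂ) • evalMonomial (fun a b => G.bracket a b) (Sum.elim A B) u) =
      evalMonomial (fun a b => ⁅a, b⁆)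
        (fun a => G.tensorRep e (Sum.elim A B a, Sum.elim A B a)) u := by
  induction u with
  | ih1 a => simp [evalMonomial]
  | ih2 u v ihu ihv =>
    obtain ⟨hu, hv, huv⟩ := hu
    have hmu := G.evalMonomial_mem hA hB u
    have hmv := G.evalMonomial_mem hA hB v
    change _ = ⁅evalMonomial _ _ u, evalMonomial _ _ v⁆
    rw [← ihu hu, ← ihv hv, G.lie_tensorRep he ⟨hmu, Submodule.smul_mem _ _ hmu⟩
      ⟨hmv, Submodule.smul_mem _ _ hmv⟩ (by rwa [abs_mul_add_mul he])]
    congr 1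
    -- The ε-part obeys the Leibniz rule, matching the additivity of length.
    refine Prod.ext rfl ?_
    change (((u.length + v.length : ℕ) : ℂ)) • G.bracket _ _ = G.bracket _ _ + G.bracket _ _
    rw [map_smul, map_smul, LinearMap.smul_apply, ← add_smul, Nat.cast_add, add_comm]

/-- A linear combination of local monomials of degree zero with `k ≠ 0` letters which vanishes in the
free Lie algebra vanishes identically in every local Lie algebra. -/
theorem eval_eq_zero_of_length_eq (he : e = 1 ∨ e = -1) (hA : ∀ i, A i ∈ G.piece (-e))
    (hB : ∀ j, B j ∈ G.piece e) {Q : LiePolyExpr (LieVar n)} {k : ℕ} (hk : k ≠ 0)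
    (hQ : ∀ u ∈ Q.support, MakesSenseLocally u ∧ monomialDegree u = 0 ∧ u.length = k)
    (hzero : Q.eval (fun a b => ⁅a, b⁆) (FreeLieAlgebra.of ℂ) = 0) :
    Q.eval (fun a b => G.bracket a b) (Sum.elim A B) = 0 := by
  have hmem : Q.eval (fun a b => G.bracket a b) (Sum.elim A B) ∈ G.piece 0 := by
    refine Submodule.sum_mem _ fun u hu => Submodule.smul_mem _ _ ?_
    have := G.evalMonomial_mem hA hB u
    rwa [(hQ u hu).2.1, mul_zero] at this
  let φ : FreeLieAlgebra ℂ (LieVar n) →ₗ⁅ℂ⁆ Module.End ℂ (TensorAlgebra ℂ ((Γ × Γ) × (Γ × ℂ))) :=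
    FreeLieAlgebra.lift ℂ fun a => G.tensorRep e (Sum.elim A B a, Sum.elim A B a)
  have h1 : Q.eval (fun a b => ⁅a, b⁆)
      (fun a => G.tensorRep e (Sum.elim A B a, Sum.elim A B a)) = 0 := by
    have h := LiePolyExpr.lieHom_eval φ (FreeLieAlgebra.of ℂ) Q
    rw [hzero, FreeLieAlgebra.of_comp_lift] at h
    exact h.symm.trans (map_zero φ.toLinearMap)
  let ψ : Γ →ₗ[ℂ] Module.End ℂ (TensorAlgebra ℂ ((Γ × Γ) × (Γ × ℂ))) :=
    G.tensorRep e ∘ₗ LinearMap.prod LinearMap.id ((k : ℂ) • LinearMap.id)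
  have h2 := LiePolyExpr.map_eval (fun a b => G.bracket a b) (Sum.elim A B) (fun a b => ⁅a, b⁆)
    (fun a => G.tensorRep e (Sum.elim A B a, Sum.elim A B a)) ψ Q fun u hu => by
      rw [← G.tensorRep_evalMonomial he hA hB (hQ u hu).1, (hQ u hu).2.2]
      rfl
  have h0 := G.eq_zero_of_tensorRep_eq_zero he ⟨hmem, Submodule.smul_mem _ (k : ℂ) hmem⟩
    (h2.trans h1)
  exact (smul_eq_zero.1 h0).resolve_left (Nat.cast_ne_zero.2 hk)

/-- The part of degree zero of a local expression vanishes identically in every local Lie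
algebra. -/
theorem proj_zero_eval (he : e = 1 ∨ e = -1) (hA : ∀ i, A i ∈ G.piece (-e))
    (hB : ∀ j, B j ∈ G.piece e) (hn : 2 ≤ n) {P : LiePolyExpr (LieVar n)}
    (hP : IsLocalExpression n P) :
    G.proj 0 (P.eval (fun a b => G.bracket a b) (Sum.elim A B)) = 0 := by
  classical
  rw [← P.sum_ofLength (s := P.support.image FreeMagma.length)
    fun u hu => Finset.mem_image_of_mem _ hu]
  rw [LiePolyExpr.eval_eq_linearCombination, map_sum, map_sum]
  refine Finset.sum_eq_zero fun k hk => ?_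
  rw [← LiePolyExpr.eval_eq_linearCombination]
  have hsupp := fun u hu => LiePolyExpr.mem_support_ofLength (P := P) (k := k) (u := u) hu
  have hdeg : ∀ u ∈ (P.ofLength k).support, (monomialDegree u - k) % 2 = 0 := fun u hu => by
    rw [← (hsupp u hu).2]; exact monomialDegree_emod_two u
  -- Even length differs from the length 2n - 1 of the target, so this component vanishes in the
  -- free Lie algebra. Odd length forces odd degree, so the projection to degree 0 is zero term by
  -- term.
  rcases Nat.even_or_odd' k with ⟨c, hc | hc⟩
  · have hk0 : k ≠ 0 := by
      obtain ⟨u, -, rfl⟩ := Finset.mem_image.1 hk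
      exact u.length_pos.ne'
    have hzero : (P.ofLength k).eval (fun a b => ⁅a, b⁆) (FreeLieAlgebra.of ℂ) = 0 := by
      refine LiePolyExpr.eval_ofLength_eq_zero hP.2 (doubling_nestedLie fun x hx => ?_) ?_
      · rw [List.mem_append, List.mem_ofFn, List.mem_ofFn] at hx
        rcases hx with ⟨i, rfl⟩ | ⟨i, rfl⟩ <;> exact FreeLieAlgebra.lift_of_apply _ _
      · rw [List.length_append, List.length_ofFn, List.length_ofFn]; omega
    rw [G.eval_eq_zero_of_length_eq he hA hB hk0 (fun u hu => ?_) hzero, map_zero]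
    have hloc := hP.1 u (hsupp u hu).1
    have h1 := hloc.abs_monomialDegree_le
    have h2 := hdeg u hu
    rw [abs_le] at h1
    exact ⟨hloc, by omega, (hsupp u hu).2⟩
  · rw [LiePolyExpr.eval, Finsupp.sum, map_sum]
    refine Finset.sum_eq_zero fun u hu => ?_
    rw [map_smul, G.proj_of_mem_ne (G.evalMonomial_mem hA hB u), smul_zero]
    have h2 := hdeg u hu
    rcases he with rfl | rfl <;> omega

/-- Components of degree ±1 vanish by injectivity of Γ → `GMax` there; the degree-0 component
vanishes unconditionally. -/
theorem eval_eq_zero_of_toGMax_eq_zero (he : e = 1 ∨ e = -1) (hA : ∀ i, A i ∈ G.piece (-e))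
    (hB : ∀ j, B j ∈ G.piece e) (hn : 2 ≤ n) {P : LiePolyExpr (LieVar n)}
    (hP : IsLocalExpression n P)
    (h : G.toGMax (P.eval (fun a b => G.bracket a b) (Sum.elim A B)) = 0) :
    P.eval (fun a b => G.bracket a b) (Sum.elim A B) = 0 := by
  rw [← G.proj_add_proj_add_proj (P.eval _ _), G.proj_zero_eval he hA hB hn hP,
    G.proj_eq_zero_of_toGMax_eq_zero (.inl rfl) h, G.proj_eq_zero_of_toGMax_eq_zero (.inr rfl) h]
  simp

end LocalLieAlgebra

/-! ### Graded pieces of the maximal algebra as nested brackets -/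

/-- The spaces of nested brackets attached to a local triple, indexed by their degree. -/
def gradedNestedSpan {L : Type*} [LieRing L] [LieAlgebra ℂ L] (P Z M : Submodule ℂ L) :
    ℤ → Submodule ℂ L
  | .ofNat k => nestedSpan P Z k
  | .negSucc k => nestedSpan M Z (k + 1)

theorem gradedNestedSpan_natCast {L : Type*} [LieRing L] [LieAlgebra ℂ L] (P Z M : Submodule ℂ L)
    (k : ℕ) : gradedNestedSpan P Z M k = nestedSpan P Z k := rfl

theorem gradedNestedSpan_neg_natCast {L : Type*} [LieRing L] [LieAlgebra ℂ L]
    (P Z M : Submodule ℂ L) (k : ℕ) : gradedNestedSpan P Z M (-k) = nestedSpan M Z k := by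
  cases k <;> rfl

/-- For factors of opposite signs, the shorter one lowers the longer one, which decides whether `h`
or `h.symm` applies. -/
theorem IsLocalTriple.lie_mem_gradedNestedSpan {L : Type*} [LieRing L] [LieAlgebra ℂ L]
    {P Z M : Submodule ℂ L} (h : IsLocalTriple P Z M) {i j : ℤ} {x y : L}
    (hx : x ∈ gradedNestedSpan P Z M i) (hy : y ∈ gradedNestedSpan P Z M j) :
    ⁅x, y⁆ ∈ gradedNestedSpan P Z M (i + j) := by
  have mixed : ∀ (a b : ℕ) {x y : L}, x ∈ nestedSpan P Z a → y ∈ nestedSpan M Z b →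
      ⁅x, y⁆ ∈ gradedNestedSpan P Z M (a + -b) := by
    intro a b x y hx hy
    rcases le_total b a with hab | hab
    · obtain ⟨c, rfl⟩ := Nat.exists_eq_add_of_le' hab
      rw [show ((c + b : ℕ) : ℤ) + -b = c by push_cast; ring, gradedNestedSpan_natCast]
      exact h.nestedSpan_lie_neg_mem hx hy
    · obtain ⟨c, rfl⟩ := Nat.exists_eq_add_of_le' hab
      rw [show (a : ℤ) + -((c + a : ℕ) : ℤ) = -c by push_cast; ring,
        gradedNestedSpan_neg_natCast]
      exact lie_mem_of_lie_mem_swap (h.symm.nestedSpan_lie_neg_mem hy hx)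
  obtain ⟨a, rfl | rfl⟩ := i.eq_nat_or_neg <;> obtain ⟨b, rfl | rfl⟩ := j.eq_nat_or_neg <;>
    simp only [gradedNestedSpan_natCast, gradedNestedSpan_neg_natCast] at hx hy
  · exact h.nestedSpan_lie_mem hx hy
  · exact mixed a b hx hy
  · rw [add_comm]
    exact lie_mem_of_lie_mem_swap (mixed b a hy hx)
  · rw [← neg_add, ← Nat.cast_add, gradedNestedSpan_neg_natCast]
    exact h.symm.nestedSpan_lie_mem hx hy

theorem two_zpow_injective : Function.Injective fun k : ℤ => (2 : ℂ) ^ k := by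
  have h : Function.Injective fun k : ℤ => (2 : ℝ) ^ k :=
    zpow_right_injective₀ (by norm_num) (by norm_num)
  intro a b hab
  refine h (Complex.ofReal_injective ?_)
  simpa using hab

namespace LocalLieAlgebra

variable {Γ : Type*} [AddCommGroup Γ] [Module ℂ Γ] (G : LocalLieAlgebra Γ)

/-- The image in the maximal graded Lie algebra of a homogeneous subspace of `Γ`. -/
def localPiece (i : ℤ) : Submodule ℂ G.GMax := (G.piece i).map G.toGMaxₗ

theorem toGMax_mem_localPiece {i : ℤ} {x : Γ} (hx : x ∈ G.piece i) :
    G.toGMax x ∈ G.localPiece i := ⟨x, hx, rfl⟩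

theorem lie_mem_localPiece {i j : ℤ} (hij : |i + j| ≤ 1) {x y : G.GMax} (hx : x ∈ G.localPiece i)
    (hy : y ∈ G.localPiece j) : ⁅x, y⁆ ∈ G.localPiece (i + j) := by
  obtain ⟨x, hx, rfl⟩ := hx
  obtain ⟨y, hy, rfl⟩ := hy
  rw [toGMaxₗ_apply, toGMaxₗ_apply, G.lie_toGMax hx hy hij]
  exact G.toGMax_mem_localPiece (G.bracket_mem i j x y hx hy)

theorem isLocalTriple_localPiece {e : ℤ} (he : e = 1 ∨ e = -1) :
    IsLocalTriple (G.localPiece e) (G.localPiece 0) (G.localPiece (-e)) where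
  zero_zero _ hx _ hy := by
    simpa using G.lie_mem_localPiece (i := 0) (j := 0) (by decide) hx hy
  zero_pos _ hx _ hy := by
    simpa using G.lie_mem_localPiece (i := 0) (j := e)
      (by rcases he with rfl | rfl <;> decide) hx hy
  zero_neg _ hx _ hy := by
    simpa using G.lie_mem_localPiece (i := 0) (j := -e)
      (by rcases he with rfl | rfl <;> decide) hx hy
  neg_pos _ hx _ hy := by
    simpa using G.lie_mem_localPiece (i := -e) (j := e) (by simp) hx hy

theorem lie_mem_gMaxPiece {i j : ℤ} {x y : G.GMax} (hx : x ∈ G.gMaxPiece i)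
    (hy : y ∈ G.gMaxPiece j) : ⁅x, y⁆ ∈ G.gMaxPiece (i + j) :=
  lie_mem_of_mem_span (fun a ha b hb => Submodule.subset_span (.lie i j a b ha hb)) hx hy

theorem localPiece_le_gMaxPiece (i : ℤ) : G.localPiece i ≤ G.gMaxPiece i := by
  rintro _ ⟨x, hx, rfl⟩
  exact Submodule.subset_span (.of i x hx)

theorem nestedSpan_le_gMaxPiece (e : ℤ) : ∀ k : ℕ,
    nestedSpan (G.localPiece e) (G.localPiece 0) k ≤ G.gMaxPiece (e * k)
  | 0 => by simpa using G.localPiece_le_gMaxPiece 0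
  | 1 => by simpa using G.localPiece_le_gMaxPiece e
  | k + 2 => nestedSpan_add_two_induction fun x hx y hy => by
    have := G.lie_mem_gMaxPiece (G.localPiece_le_gMaxPiece e hx)
      (nestedSpan_le_gMaxPiece e (k + 1) hy)
    rwa [show e + e * ((k + 1 : ℕ) : ℤ) = e * ((k + 2 : ℕ) : ℤ) by push_cast; ring] at this

theorem gMaxPiece_le_gradedNestedSpan (i : ℤ) : G.gMaxPiece i ≤
    gradedNestedSpan (G.localPiece 1) (G.localPiece 0) (G.localPiece (-1)) i := by
  refine Submodule.span_le.2 fun a ha => ?_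
  induction ha with
  | of i x hx =>
    by_cases hi : 1 < |i|
    · rw [G.eq_zero_of_mem hi hx, ← toGMaxₗ_apply, map_zero]
      exact zero_mem _
    · have : i = 1 ∨ i = 0 ∨ i = -1 := by rw [lt_abs] at hi; omega
      rcases this with rfl | rfl | rfl <;> exact G.toGMax_mem_localPiece hx
  | lie i j a b _ _ ha hb => exact (G.isLocalTriple_localPiece (.inl rfl)).lie_mem_gradedNestedSpan ha hb

theorem gMaxPiece_mul {e : ℤ} (he : e = 1 ∨ e = -1) (k : ℕ) :
    G.gMaxPiece (e * k) = nestedSpan (G.localPiece e) (G.localPiece 0) k := by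
  refine le_antisymm ?_ (G.nestedSpan_le_gMaxPiece e k)
  have := G.gMaxPiece_le_gradedNestedSpan (e * k)
  rcases he with rfl | rfl
  · rwa [one_mul, gradedNestedSpan_natCast, ← one_mul (k : ℤ)] at this
  · rw [neg_one_mul] at this ⊢
    rwa [gradedNestedSpan_neg_natCast] at this

theorem gMaxPiece_eq_localPiece {i : ℤ} (hi : |i| ≤ 1) : G.gMaxPiece i = G.localPiece i := by
  have : i = 1 ∨ i = 0 ∨ i = -1 := by rw [abs_le] at hi; omega
  rcases this with rfl | rfl | rfl
  · simpa using G.gMaxPiece_mul (.inl rfl) 1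
  · simpa using G.gMaxPiece_mul (.inl rfl) 0
  · simpa using G.gMaxPiece_mul (.inr rfl) 1

theorem finiteDimensional_gMaxPiece (i : ℤ) : FiniteDimensional ℂ (G.gMaxPiece i) := by
  have hfin : ∀ j, FiniteDimensional ℂ (G.localPiece j) := fun j => by
    have := G.finiteDimensional j
    exact Module.Finite.map (G.piece j) _
  obtain ⟨k, rfl | rfl⟩ := i.eq_nat_or_neg
  · rw [← one_mul (k : ℤ), G.gMaxPiece_mul (.inl rfl)]
    exact finiteDimensional_nestedSpan k
  · rw [← neg_one_mul, G.gMaxPiece_mul (.inr rfl)]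
    exact finiteDimensional_nestedSpan k

theorem iSup_gMaxPiece : ⨆ i, G.gMaxPiece i = ⊤ := by
  have hspan : ⨆ i, G.gMaxPiece i = Submodule.span ℂ {a | ∃ i, G.IsMonomial i a} := by
    simp only [gMaxPiece]
    rw [← Submodule.span_iUnion, Set.ofPred_exists]
  rw [hspan, eq_top_iff]
  let S : LieSubalgebra ℂ (FreeLieAlgebra ℂ Γ) :=
    { Submodule.comap
        (LieSubmodule.Quotient.mk' (LieSubmodule.lieSpan ℂ (FreeLieAlgebra ℂ Γ)
          {r | G.MaxRelator r}) : FreeLieAlgebra ℂ Γ →ₗ[ℂ] G.GMax)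
        (Submodule.span ℂ {a | ∃ i, G.IsMonomial i a}) with
      lie_mem' := fun {x y} hx hy => by
        refine lie_mem_of_mem_span (U := Submodule.span ℂ {a | ∃ i, G.IsMonomial i a}) ?_ hx hy
        rintro a ⟨i, ha⟩ b ⟨j, hb⟩
        exact Submodule.subset_span ⟨_, .lie i j a b ha hb⟩ }
  have hS : ∀ x : Γ, FreeLieAlgebra.of ℂ x ∈ S := fun x => by
    change G.toGMax x ∈ Submodule.span ℂ {a | ∃ i, G.IsMonomial i a}
    rw [← G.proj_add_proj_add_proj x]
    simp only [← toGMaxₗ_apply, map_add]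
    exact add_mem (add_mem (Submodule.subset_span ⟨_, .of _ _ (G.proj_mem 1 x)⟩)
      (Submodule.subset_span ⟨_, .of _ _ (G.proj_mem 0 x)⟩))
      (Submodule.subset_span ⟨_, .of _ _ (G.proj_mem (-1) x)⟩)
  -- The free Lie algebra is generated by its letters: the lift into `S` followed by inclusion fixes
  -- every letter, hence is the identity, so `S` is everything.
  have hid : S.incl.comp (FreeLieAlgebra.lift ℂ fun x => (⟨FreeLieAlgebra.of ℂ x, hS x⟩ : S)) =
      LieHom.id := by
    ext x
    simp
  rintro ⟨x⟩ -
  have hx : x ∈ S := by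
    have := LieHom.congr_fun hid x
    rw [LieHom.comp_apply] at this
    rw [show x = S.incl _ from this.symm]
    exact Subtype.property _
  exact hx

/-- A subspace which is stable under the brackets with all elements of `Γ` is an ideal. -/
theorem lie_mem_of_toGMax_lie_mem {S : Submodule ℂ G.GMax}
    (h : ∀ i, ∀ x ∈ G.piece i, ∀ y ∈ S, ⁅G.toGMax x, y⁆ ∈ S) (a : G.GMax) :
    ∀ y ∈ S, ⁅a, y⁆ ∈ S := by
  have hmono : ∀ i b, G.IsMonomial i b → ∀ y ∈ S, ⁅b, y⁆ ∈ S := by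
    intro i b hb
    induction hb with
    | of i x hx => exact h i x hx
    | lie i j b c _ _ ihb ihc =>
      intro y hy
      rw [lie_lie]
      exact sub_mem (ihb _ (ihc y hy)) (ihc _ (ihb y hy))
  have ha : a ∈ ⨆ i, G.gMaxPiece i := by rw [iSup_gMaxPiece]; trivial
  intro y hy
  induction ha using Submodule.iSup_induction' with
  | mem i a ha =>
    exact lie_mem_of_mem_span (T := S) (fun b hb => hmono i b hb) ha (Submodule.subset_span hy)
  | zero => rw [zero_lie]; exact zero_mem _
  | add a b _ _ iha ihb => rw [add_lie]; exact add_mem iha ihb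

/-! ### The grading -/

/-- Multiplication by `2 ^ i` in degree `i`. -/
def scale : Γ →ₗ[ℂ] Γ := (2 : ℂ) • G.proj 1 + G.proj 0 + (2 : ℂ)⁻¹ • G.proj (-1)

theorem scale_of_mem {i : ℤ} {x : Γ} (hx : x ∈ G.piece i) : G.scale x = (2 : ℂ) ^ i • x := by
  by_cases hi : 1 < |i|
  · rw [G.eq_zero_of_mem hi hx, map_zero, smul_zero]
  · have : i = 1 ∨ i = 0 ∨ i = -1 := by rw [lt_abs] at hi; omega
    rcases this with rfl | rfl | rfl
    · simp [scale, G.proj_of_mem hx, G.proj_of_mem_ne hx (show (1 : ℤ) ≠ 0 by decide),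
        G.proj_of_mem_ne hx (show (1 : ℤ) ≠ -1 by decide)]
    · simp [scale, G.proj_of_mem hx, G.proj_of_mem_ne hx (show (0 : ℤ) ≠ 1 by decide),
        G.proj_of_mem_ne hx (show (0 : ℤ) ≠ -1 by decide)]
    · simp [scale, G.proj_of_mem hx, G.proj_of_mem_ne hx (show (-1 : ℤ) ≠ 1 by decide),
        G.proj_of_mem_ne hx (show (-1 : ℤ) ≠ 0 by decide)]

/-- The homomorphism from the free Lie algebra which induces `gMaxScale`. -/
def freeScale : FreeLieAlgebra ℂ Γ →ₗ⁅ℂ⁆ G.GMax :=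
  FreeLieAlgebra.lift ℂ fun x => G.toGMax (G.scale x)

theorem lieSpan_le_ker_freeScale :
    LieSubmodule.lieSpan ℂ (FreeLieAlgebra ℂ Γ) {r | G.MaxRelator r} ≤ G.freeScale.ker := by
  rw [LieSubmodule.lieSpan_le]
  rintro r (⟨x, y⟩ | ⟨c, x⟩ | ⟨i, j, x, y, hx, hy, hij⟩)
  · rw [SetLike.mem_coe, LieHom.mem_ker, map_sub, map_sub]
    simp only [freeScale, FreeLieAlgebra.lift_of_apply, ← toGMaxₗ_apply, map_add]
    abel
  · rw [SetLike.mem_coe, LieHom.mem_ker, map_sub, map_smul]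
    simp only [freeScale, FreeLieAlgebra.lift_of_apply, ← toGMaxₗ_apply, map_smul, sub_self]
  · rw [SetLike.mem_coe, LieHom.mem_ker, map_sub, LieHom.map_lie]
    simp only [freeScale, FreeLieAlgebra.lift_of_apply]
    rw [G.scale_of_mem hx, G.scale_of_mem hy, G.scale_of_mem (G.bracket_mem i j x y hx hy),
      G.lie_toGMax (Submodule.smul_mem _ _ hx) (Submodule.smul_mem _ _ hy) hij, map_smul, map_smul,
      LinearMap.smul_apply, smul_smul, mul_comm, ← zpow_add₀ two_ne_zero, sub_self]

/-- The endomorphism of the maximal graded Lie algebra which is multiplication by `2 ^ i` in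
degree `i`. -/
def gMaxScale : Module.End ℂ G.GMax :=
  Submodule.liftQ (LieSubmodule.lieSpan ℂ (FreeLieAlgebra ℂ Γ) {r | G.MaxRelator r}).toSubmodule
    (G.freeScale : FreeLieAlgebra ℂ Γ →ₗ[ℂ] G.GMax) G.lieSpan_le_ker_freeScale

theorem gMaxScale_toGMax (x : Γ) : G.gMaxScale (G.toGMax x) = G.toGMax (G.scale x) :=
  FreeLieAlgebra.lift_of_apply _ _

theorem gMaxScale_lie (a b : G.GMax) : G.gMaxScale ⁅a, b⁆ = ⁅G.gMaxScale a, G.gMaxScale b⁆ := by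
  obtain ⟨a⟩ := a
  obtain ⟨b⟩ := b
  exact G.freeScale.map_lie a b

theorem gMaxPiece_le_eigenspace (i : ℤ) :
    G.gMaxPiece i ≤ G.gMaxScale.eigenspace ((2 : ℂ) ^ i) := by
  refine Submodule.span_le.2 fun a ha => ?_
  rw [SetLike.mem_coe, Module.End.mem_eigenspace_iff]
  induction ha with
  | of i x hx =>
    rw [gMaxScale_toGMax, G.scale_of_mem hx, ← toGMaxₗ_apply, map_smul]
    rfl
  | lie i j a b _ _ iha ihb =>
    rw [gMaxScale_lie, iha, ihb, smul_lie, lie_smul, smul_smul, zpow_add₀ two_ne_zero]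

/-- The relators are compatible with scaling degree i by 2^i, so the pieces lie in eigenspaces for
distinct eigenvalues. -/
theorem iSupIndep_gMaxPiece : iSupIndep G.gMaxPiece :=
  ((Module.End.eigenspaces_iSupIndep _).comp two_zpow_injective).mono G.gMaxPiece_le_eigenspace

/-! ### The maximal ideal -/

theorem disjoint_far_toGMax {a : G.GMax} (ha : a ∈ ⨆ i ∈ {i : ℤ | 1 < |i|}, G.gMaxPiece i) {x : Γ}
    (hx : G.toGMax x = a) : a = 0 := by
  have hdisj := G.iSupIndep_gMaxPiece.disjoint_biSup_biSup (s := {i : ℤ | 1 < |i|})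
    (t := {i : ℤ | |i| ≤ 1})
    (Set.disjoint_left.2 fun i (h1 : 1 < |i|) (h2 : |i| ≤ 1) => h1.not_ge h2)
  refine Submodule.disjoint_def.1 hdisj a ha ?_
  have key : ∀ i : ℤ, |i| ≤ 1 → G.toGMax (G.proj i x) ∈
      ⨆ i ∈ {i : ℤ | |i| ≤ 1}, G.gMaxPiece i := fun i hi =>
    Submodule.mem_iSup_of_mem i (Submodule.mem_iSup_of_mem hi
      (G.localPiece_le_gMaxPiece i (G.toGMax_mem_localPiece (G.proj_mem i x))))
  rw [← hx, ← G.proj_add_proj_add_proj x]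
  simp only [← toGMaxₗ_apply, map_add]
  exact add_mem (add_mem (key 1 (by decide)) (key 0 (by decide))) (key (-1) (by decide))

theorem toSubmodule_jMax : G.jMax.toSubmodule = ⨆ I ∈ {I | G.IsGradedIdeal I ∧
    ∀ x : Γ, G.toGMax x ∈ I → G.toGMax x = 0}, I.toSubmodule :=
  LieSubmodule.sSup_toSubmodule_eq_iSup _

/-- In degrees -1, 0, 1 the pieces are images of Γ, so a graded ideal meeting Γ trivially has no
components there. This passes to sums of such ideals, which is why `jMax` itself meets Γ trivially.
-/
theorem jMax_le_far : G.jMax.toSubmodule ≤ ⨆ i ∈ {i : ℤ | 1 < |i|}, G.gMaxPiece i := by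
  rw [toSubmodule_jMax]
  refine iSup₂_le fun I hI => ?_
  rw [hI.1]
  refine iSup_le fun i => ?_
  by_cases hi : 1 < |i|
  · exact inf_le_right.trans (le_iSup₂_of_le i hi le_rfl)
  · rintro a ⟨haI, hai⟩
    rw [SetLike.mem_coe, G.gMaxPiece_eq_localPiece (not_lt.1 hi)] at hai
    obtain ⟨x, -, rfl⟩ := hai
    rw [toGMaxₗ_apply, hI.2 x haI]
    exact zero_mem _

theorem toGMax_eq_zero_of_mem_jMax {x : Γ} (hx : G.toGMax x ∈ G.jMax) : G.toGMax x = 0 :=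
  G.disjoint_far_toGMax (G.jMax_le_far hx) rfl

theorem isGradedIdeal_jMax : G.IsGradedIdeal G.jMax := by
  refine le_antisymm ?_ (iSup_le fun i => inf_le_left)
  nth_rewrite 1 [toSubmodule_jMax]
  refine iSup₂_le fun I hI => ?_
  rw [hI.1]
  exact iSup_mono fun i => inf_le_inf_right _ (le_sSup (a := I) hI)

theorem gMinPiece_eq_bot_iff (i : ℤ) : G.gMinPiece i = ⊥ ↔ G.gMaxPiece i ≤ G.jMax.toSubmodule := by
  rw [gMinPiece, ← le_bot_iff, Submodule.map_le_iff_le_comap]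
  exact ⟨fun h a ha => (LieSubmodule.Quotient.mk_eq_zero _).1 (h ha),
    fun h a ha => (LieSubmodule.Quotient.mk_eq_zero _).2 (h ha)⟩

/-- The endomorphism of the minimal graded Lie algebra which is multiplication by `2 ^ i` in
degree `i`. -/
def gMinScale : Module.End ℂ G.GMin :=
  Submodule.mapQ G.jMax.toSubmodule G.jMax.toSubmodule G.gMaxScale <| by
    refine (le_of_eq G.isGradedIdeal_jMax).trans (iSup_le fun i => ?_)
    rintro a ⟨haJ, hai⟩
    rw [Submodule.mem_comap, Module.End.mem_eigenspace_iff.1 (G.gMaxPiece_le_eigenspace i hai)]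
    exact Submodule.smul_mem _ _ haJ

theorem gMinPiece_le_eigenspace (i : ℤ) :
    G.gMinPiece i ≤ G.gMinScale.eigenspace ((2 : ℂ) ^ i) := by
  rintro _ ⟨a, ha, rfl⟩
  rw [Module.End.mem_eigenspace_iff]
  have h := Module.End.mem_eigenspace_iff.1 (G.gMaxPiece_le_eigenspace i ha)
  change LieSubmodule.Quotient.mk' G.jMax (G.gMaxScale a) = _
  rw [h, map_smul]
  rfl

theorem iSupIndep_gMinPiece : iSupIndep G.gMinPiece :=
  ((Module.End.eigenspaces_iSupIndep _).comp two_zpow_injective).mono G.gMinPiece_le_eigenspace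

theorem iSup_gMinPiece : ⨆ i, G.gMinPiece i = ⊤ := by
  simp only [gMinPiece]
  rw [← Submodule.map_iSup, iSup_gMaxPiece, Submodule.map_top]
  exact LinearMap.range_eq_top.2 (LieSubmodule.Quotient.surjective_mk' _)

/-- The annihilated elements span a graded ideal which meets `Γ` trivially. -/
theorem annihilated_le_jMax {e : ℤ} (he : e = 1 ∨ e = -1) (k : ℕ) :
    annihilated (G.localPiece e) (G.localPiece 0) (G.localPiece (-e)) k ≤ G.jMax.toSubmodule := by
  have h := G.isLocalTriple_localPiece he
  set J := annihilated (G.localPiece e) (G.localPiece 0) (G.localPiece (-e))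
  have hstable : ∀ i, ∀ x ∈ G.piece i, ∀ y ∈ ⨆ k, J k, ⁅G.toGMax x, y⁆ ∈ ⨆ k, J k := by
    intro i x hx y hy
    by_cases hi : 1 < |i|
    · rw [G.eq_zero_of_mem hi hx, ← toGMaxₗ_apply, map_zero, zero_lie]
      exact zero_mem _
    have hx' := G.toGMax_mem_localPiece hx
    suffices hle : ⨆ k, J k ≤ lieComap (G.toGMax x) (⨆ k, J k) from hle hy
    refine iSup_le fun k y hy => ?_
    change ⁅G.toGMax x, y⁆ ∈ ⨆ k, J k
    have : i = e ∨ i = 0 ∨ i = -e := by rw [lt_abs] at hi; omega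
    rcases this with rfl | rfl | rfl
    · exact Submodule.mem_iSup_of_mem (k + 1) (h.pos_lie_mem_annihilated hx' hy)
    · exact Submodule.mem_iSup_of_mem k (h.zero_lie_mem_annihilated hx' hy)
    · cases k with
      | zero =>
        rw [(Submodule.mem_bot ℂ).1 hy]
        exact zero_mem (lieComap (G.toGMax x) (⨆ k, J k))
      | succ k => exact Submodule.mem_iSup_of_mem k (neg_lie_mem_annihilated hx' hy)
  let I : LieIdeal ℂ G.GMax :=
    { (⨆ k, J k : Submodule ℂ G.GMax) with
      lie_mem := fun {a y} hy => G.lie_mem_of_toGMax_lie_mem hstable a y hy }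
  have hpiece : ∀ k, J k ≤ G.gMaxPiece (e * k) := fun k =>
    (annihilated_le_nestedSpan _ _ _ k).trans (G.nestedSpan_le_gMaxPiece e k)
  have hI : I ≤ G.jMax := by
    refine le_sSup ⟨le_antisymm ?_ (iSup_le fun i => inf_le_left), fun x hx => ?_⟩
    · exact iSup_le fun k => le_iSup_of_le (e * k) (le_inf (le_iSup J k) (hpiece k))
    · refine G.disjoint_far_toGMax ((iSup_le fun k => ?_ : ⨆ k, J k ≤ _) hx) rfl
      match k with
      | 0 => exact bot_le
      | 1 => exact bot_le
      -- Nonzero annihilated elements start at k = 2, hence outside the local part.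
      | k + 2 =>
        refine (hpiece (k + 2)).trans (le_iSup₂_of_le (e * ((k + 2 : ℕ) : ℤ)) ?_ le_rfl)
        change 1 < |e * ((k + 2 : ℕ) : ℤ)|
        rw [lt_abs]
        rcases he with rfl | rfl <;> omega
  exact (le_iSup J k).trans hI

/-! ### The criterion for the vanishing of the minimal graded Lie algebra in high degrees -/

theorem exists_ofFn_toGMax {i : ℤ} {n : ℕ} {l : List G.GMax} (hn : l.length = n)
    (hl : ∀ a ∈ l, a ∈ G.localPiece i) :
    ∃ B : Fin n → Γ, (∀ j, B j ∈ G.piece i) ∧ l = List.ofFn fun j => G.toGMax (B j) := by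
  subst hn
  choose B hB hBl using fun j : Fin l.length => hl (l.get j) (l.get_mem j)
  refine ⟨B, hB, ?_⟩
  conv_lhs => rw [← List.ofFn_get l]
  exact congrArg List.ofFn (funext fun j => (hBl j).symm)

/-- Forward, degree en alone suffices: its elements lie in `jMax`, which absorbs the brackets with
the A's and meets Γ trivially. Backward, the identity says that degree en is annihilated, and this
propagates to every k ≥ n. -/
theorem gMinPiece_eq_bot_iff_identityHolds {e : ℤ} (he : e = 1 ∨ e = -1) {n : ℕ} (hn : 2 ≤ n)
    {P : LiePolyExpr (LieVar n)} (hP : IsLocalExpression n P) :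
    (∀ k : ℕ, n ≤ k → G.gMinPiece (e * k) = ⊥) ↔ G.IdentityHolds (-e) P := by
  have h := G.isLocalTriple_localPiece he
  constructor
  · intro hbot A B hA hB
    rw [neg_neg] at hB
    refine G.eval_eq_zero_of_toGMax_eq_zero he hA hB hn hP (G.toGMax_eq_zero_of_mem_jMax ?_)
    rw [G.toGMax_eval he hA hB hn hP]
    have hnest : nestedLie (List.ofFn fun j => G.toGMax (B j)) ∈ G.jMax := by
      refine (G.gMinPiece_eq_bot_iff _).1 (hbot n le_rfl) (G.nestedSpan_le_gMaxPiece e n ?_)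
      obtain ⟨k, rfl⟩ : ∃ k, n = k + 1 := ⟨n - 1, by omega⟩
      refine nestedLie_mem_nestedSpan _ _ (List.length_ofFn) fun x hx => ?_
      obtain ⟨j, rfl⟩ := List.mem_ofFn.1 hx
      exact G.toGMax_mem_localPiece (hB j)
    generalize (List.ofFn fun i => G.toGMax (A i)) = l
    induction l with
    | nil => exact hnest
    | cons a l ih => exact G.jMax.lie_mem ih
  · intro hid k hk
    rw [gMinPiece_eq_bot_iff, G.gMaxPiece_mul he]
    refine (h.nestedSpan_le_annihilated (by omega) ?_ hk).trans (G.annihilated_le_jMax he k)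
    obtain ⟨m, rfl⟩ : ∃ m, n = m + 1 := ⟨n - 1, by omega⟩
    refine (nestedSpan_le_span _ _ m).trans (Submodule.span_le.2 ?_)
    rintro _ ⟨l, ⟨hl, hle⟩, rfl⟩
    refine h.mem_annihilated_of_foldr (nestedLie_mem_nestedSpan _ _ hl hle) fun l' hl' hle' => ?_
    obtain ⟨B, hB, rfl⟩ := G.exists_ofFn_toGMax hl hle
    obtain ⟨A, hA, rfl⟩ := G.exists_ofFn_toGMax hl' hle'
    have := G.toGMax_eval (n := m + 1) he hA hB hn hP
    rw [hid A B hA (by simpa using hB), ← toGMaxₗ_apply, map_zero] at this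
    exact this.symm

theorem finiteDimensional_gMin {m n : ℕ} (hm : ∀ i : ℤ, (m : ℤ) ≤ i → G.gMinPiece i = ⊥)
    (hn : ∀ i : ℤ, i ≤ -(n : ℤ) → G.gMinPiece i = ⊥) : FiniteDimensional ℂ G.GMin := by
  have htop : (Finset.Icc (-(n : ℤ)) m).sup G.gMinPiece = ⊤ := by
    rw [eq_top_iff, ← iSup_gMinPiece]
    refine iSup_le fun i => ?_
    by_cases hi : i ∈ Finset.Icc (-(n : ℤ)) m
    · exact Finset.le_sup (f := G.gMinPiece) hi
    · have : (m : ℤ) ≤ i ∨ i ≤ -(n : ℤ) := by rw [Finset.mem_Icc] at hi; omega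
      rcases this with h | h
      · rw [hm i h]; exact bot_le
      · rw [hn i h]; exact bot_le
  have hfin : ∀ i, FiniteDimensional ℂ (G.gMinPiece i) := fun i => by
    have := G.finiteDimensional_gMaxPiece i
    exact Module.Finite.map (G.gMaxPiece i) _
  rw [FiniteDimensional, Module.finite_def, ← htop, ← Module.Finite.iff_fg]
  infer_instance

theorem exists_gMinPiece_eq_bot [FiniteDimensional ℂ G.GMin] :
    ∃ N : ℕ, 2 ≤ N ∧ ∀ i : ℤ, (N : ℤ) ≤ |i| → G.gMinPiece i = ⊥ := by
  -- A Noetherian module contains only finitely many nonzero members of an independent family.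
  have hfin := (WellFoundedGT.finite_ne_bot_of_iSupIndep G.iSupIndep_gMinPiece).image Int.natAbs
  obtain ⟨N, hN⟩ := hfin.bddAbove
  -- Adding 2 both passes the bound `N` strictly and secures 2 ≤ N + 2.
  refine ⟨N + 2, by omega, fun i hi => ?_⟩
  by_contra hne
  have := hN ⟨i, hne, rfl⟩
  rw [Int.abs_eq_natAbs] at hi
  omega

end LocalLieAlgebra
end

theorem theorem2 {Γ : Type*} [AddCommGroup Γ] [Module ℂ Γ] (G : LocalLieAlgebra Γ) :
    (∀ n : ℕ, 2 ≤ n → ∃ P : LiePolyExpr (LieVar n), IsLocalExpression n P) ∧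
    ∀ P : (n : ℕ) → LiePolyExpr (LieVar n), (∀ n : ℕ, 2 ≤ n → IsLocalExpression n (P n)) →
      (∀ n : ℕ, 2 ≤ n →
        ((∀ i : ℤ, (n : ℤ) ≤ i → G.gMinPiece i = ⊥) ↔ G.IdentityHolds (-1) (P n))) ∧
      (∀ n : ℕ, 2 ≤ n →
        ((∀ i : ℤ, i ≤ -(n : ℤ) → G.gMinPiece i = ⊥) ↔ G.IdentityHolds 1 (P n))) ∧
      (FiniteDimensional ℂ G.GMin ↔
        ∃ m n : ℕ, 2 ≤ m ∧ 2 ≤ n ∧ G.IdentityHolds (-1) (P m) ∧ G.IdentityHolds 1 (P n)) := by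
  refine ⟨fun n hn => exists_isLocalExpression hn, fun P hP => ?_⟩
  have h1 : ∀ n : ℕ, 2 ≤ n →
      ((∀ i : ℤ, (n : ℤ) ≤ i → G.gMinPiece i = ⊥) ↔ G.IdentityHolds (-1) (P n)) := by
    intro n hn
    rw [← G.gMinPiece_eq_bot_iff_identityHolds (.inl rfl) hn (hP n hn)]
    refine ⟨fun h k hk => h _ (by omega), fun h i hi => ?_⟩
    obtain ⟨k, rfl⟩ := Int.eq_ofNat_of_zero_le (show 0 ≤ i by omega)
    simpa using h k (by omega)
  have h2 : ∀ n : ℕ, 2 ≤ n →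
      ((∀ i : ℤ, i ≤ -(n : ℤ) → G.gMinPiece i = ⊥) ↔ G.IdentityHolds 1 (P n)) := by
    intro n hn
    have h := G.gMinPiece_eq_bot_iff_identityHolds (.inr rfl) hn (hP n hn)
    rw [neg_neg] at h
    rw [← h]
    refine ⟨fun h k hk => h _ (by omega), fun h i hi => ?_⟩
    obtain ⟨k, hk⟩ := Int.eq_ofNat_of_zero_le (show 0 ≤ -i by omega)
    rw [show i = -1 * (k : ℤ) by omega]
    exact h k (by omega)
  refine ⟨h1, h2, fun h => ?_, ?_⟩
  · obtain ⟨N, hN, hbot⟩ := G.exists_gMinPiece_eq_bot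
    exact ⟨N, N, hN, hN, (h1 N hN).1 fun i hi => hbot i (hi.trans (le_abs_self i)),
      (h2 N hN).1 fun i hi => hbot i (by rw [le_abs]; omega)⟩
  · rintro ⟨m, n, hm, hn, hPm, hPn⟩
    exact G.finiteDimensional_gMin ((h1 m hm).2 hPm) ((h2 n hn).2 hPn)
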